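/- For a set $A$ of positive integers let $p_A(n)$ denote the number of partitions of $n$ all of whose parts lie in $A$, let $p(n)$ denote the number of all partitions of $n$, and let the lower density of $A$ be $\liminf_{n\to\infty}|A\cap\{1,\dots,n\}|/n$. Write $\log$ for the natural logarithm, with $\log 0=-\infty$, and let $o_\alpha(1)$ denote a quantity that depends only on $\alpha$ and tends to $0$ as $\alpha\to 0^+$. For every $0<\alpha<1$ there is a set $A$ of positive integers of lower density $\alpha$ with $\gcd(A)=1$ satisfying $$\liminf_{n\to\infty}\frac{\log p_A(n)}{\log p(\lfloor\alpha n\rfloor)}\ \ge\ (1-o_\alpha(1))\,\frac{\sqrt6}{\pi}\,\log(1/\alpha).$$ Furthermore, this lower bound is best possible: for every $0<\alpha<1$, every set $A$ of positive integers of lower density $\alpha$ satisfies $$\liminf_{n\to\infty}\frac{\log p_A(n)}{\log p(\lfloor\alpha n\rfloor)}\ \le\ (1+o_\alpha(1))\,\frac{\sqrt6}{\pi}\,\log(1/\alpha).$$ -/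

import Mathlib

open Filter Topology
open scoped ENNReal

noncomputable section

/-- `p(n)`: the number of partitions of `n`. -/
def partitionCount (n : ℕ) : ℕ :=
  Nat.card (Nat.Partition n)

/-- `p_A(n)`: the number of partitions of `n` all of whose parts lie in `A`. -/
def restrictedPartitionCount (A : Set ℕ) (n : ℕ) : ℕ :=
  Nat.card {P : Nat.Partition n // ∀ i ∈ P.parts, i ∈ A}

/-- The lower (asymptotic) density `liminf |A ∩ {1, …, n}| / n`. The sequence takes values in
`[0, 1]`, so the real-valued lower limit is the genuine one. -/
def lowerDensity (A : Set ℕ) : ℝ :=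
  liminf (fun n : ℕ => ((A ∩ Set.Icc 1 n).ncard : ℝ) / (n : ℝ)) atTop

/-- The lower limit of `log p_A(n) / log p(⌊α n⌋)` as `n → ∞`, in the extended reals, with
`log 0 = -∞`. The denominator is a positive real number as soon as `⌊α n⌋ ≥ 2`. -/
def liminfLogRatio (A : Set ℕ) (α : ℝ) : EReal :=
  liminf (fun n : ℕ =>
    ENNReal.log (restrictedPartitionCount A n : ℝ≥0∞) /
      ((Real.log (partitionCount ⌊α * (n : ℝ)⌋₊ : ℝ) : ℝ) : EReal)) atTop

end

/-! Write L = log(1/α) and b = π²/6. Since log p(m) ~ 2√(bm), taking n = αX² gives log p(⌊αn⌋) ~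
2(π/√6)αX, so both halves amount to comparing log p_A(n) with 2αXL.

Upper bound. Lower density α supplies arbitrarily large N with at most (1+η)αN elements of A up to
N; take n = ⌊αN²⌋. The generating function bound p_A(n) ≤ e^{ns} ∏ (1-e^{-sa})⁻¹ is used at s = L/N.
The factor e^{ns} contributes αNL to the logarithm. The few parts up to N contribute at most about L
each, hence about αNL together. Since e^{-sN} = α, the parts beyond N contribute only O(αN), even if
all of them lie in A. This is `log_restrictedPartitionCount_le_of_sparse`.

Lower bound. Remove from the positive integers the gaps (αj!, j!], keeping 1, which forces gcd 1 and
can fill up any remainder. Factorials grow so fast that the density dips to α only at the ends of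
gaps. When a factorial N is comparable to X, two independent choices are available: multiplicities
up to about 1/α for the roughly αN parts just below the gap, giving αNL, and a set of about n/N
parts just above it, giving (n/N)L. By AM-GM, αN + n/N ≥ 2αX, with equality at N = X. When no
factorial is comparable to X, one of the two choices alone, made at N = X/4 or N = 4X, already gives
4αXL. This is `le_log_restrictedPartitionCount_factorialGapSet`.

The asymptotics of log p come from the same generating function bound together with an elementary
Tauberian argument, `eventually_le_log_partitionCount`. -/

/-! ### Counting partitions by multiplicities; generating function inequalities. -/

lemma finset_card_le_restrictedPartitionCount {ι : Type*} {A : Set ℕ} {n : ℕ} (T : Finset ι)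
    (φ : ι → Multiset ℕ) (hinj : Set.InjOn φ T) (hA : ∀ i ∈ T, ∀ a ∈ φ i, a ∈ A ∧ 0 < a)
    (hs : ∀ i ∈ T, (φ i).sum = n) : T.card ≤ restrictedPartitionCount A n := by
  classical
  let ψ : T → {P : Nat.Partition n // ∀ i ∈ P.parts, i ∈ A} := fun i =>
    ⟨⟨φ i, fun h => (hA i i.2 _ h).2, hs i i.2⟩, fun a ha => (hA i i.2 a ha).1⟩
  have hψ : Function.Injective ψ := by
    intro i j h
    have h1 : φ i = φ j := congrArg (fun P => P.1.parts) h
    exact Subtype.ext (hinj i.2 j.2 h1)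
  have := Nat.card_le_card_of_injective ψ hψ
  simpa [restrictedPartitionCount] using this

lemma partitionCount_eq_restrictedPartitionCount_univ (n : ℕ) :
    partitionCount n = restrictedPartitionCount Set.univ n := by
  unfold partitionCount restrictedPartitionCount
  exact Nat.card_congr (Equiv.subtypeUnivEquiv (fun P i _ => Set.mem_univ i)).symm

lemma restrictedPartitionCount_mono {A B : Set ℕ} (h : A ⊆ B) (n : ℕ) :
    restrictedPartitionCount A n ≤ restrictedPartitionCount B n :=
  Nat.card_le_card_of_injective
    (fun P : {P : Nat.Partition n // ∀ i ∈ P.parts, i ∈ A} =>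
      (⟨P.1, fun i hi => h (P.2 i hi)⟩ : {P : Nat.Partition n // ∀ i ∈ P.parts, i ∈ B}))
    fun _ _ h => Subtype.ext (congrArg (fun R => R.1) h)

/-- The multiset in which each `a ∈ S` has multiplicity `g a`. -/
def multisetOfMult (S : Finset ℕ) (g : S → ℕ) : Multiset ℕ :=
  ∑ a : S, Multiset.replicate (g a) (a : ℕ)

lemma count_multisetOfMult (S : Finset ℕ) (g : S → ℕ) (a : S) :
    (multisetOfMult S g).count (a : ℕ) = g a := by
  classical
  rw [multisetOfMult, Multiset.count_sum']
  simp only [Multiset.count_replicate]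
  rw [Finset.sum_eq_single a]
  · simp
  · intro b _ hb
    rw [if_neg]
    exact fun h => hb (Subtype.ext h)
  · simp

lemma mem_of_mem_multisetOfMult {S : Finset ℕ} {g : S → ℕ} {a : ℕ}
    (h : a ∈ multisetOfMult S g) : a ∈ S := by
  rw [multisetOfMult, Multiset.mem_sum] at h
  obtain ⟨b, _, hb⟩ := h
  rw [Multiset.eq_of_mem_replicate hb]
  exact b.2

lemma sum_multisetOfMult (S : Finset ℕ) (g : S → ℕ) :
    (multisetOfMult S g).sum = ∑ a : S, g a * (a : ℕ) := by
  rw [multisetOfMult, Multiset.sum_sum]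
  simp

lemma multisetOfMult_injective (S : Finset ℕ) : Function.Injective (multisetOfMult S) := by
  intro g h e
  funext a
  rw [← count_multisetOfMult S g a, e, count_multisetOfMult]

/-- A partition is determined by its vector of multiplicities, each at most n. Expanding the product
gives a sum over such vectors, in which every admissible partition of n accounts for one term x^n.
-/
lemma restrictedPartitionCount_mul_pow_le {A : Set ℕ} {n : ℕ} {B : Finset ℕ}
    (hB : ∀ a ∈ A, 1 ≤ a → a ≤ n → a ∈ B) {x : ℝ} (hx : 0 ≤ x) :
    (restrictedPartitionCount A n : ℝ) * x ^ n ≤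
      ∏ a ∈ B, ∑ k ∈ Finset.range (n + 1), x ^ (k * a) := by
  classical
  rw [← Finset.prod_coe_sort, Finset.prod_univ_sum]
  let ψ : {P : Nat.Partition n // ∀ i ∈ P.parts, i ∈ A} → (B → ℕ) :=
    fun P a => P.1.parts.count (a : ℕ)
  have hle : ∀ (P : Nat.Partition n) (a : ℕ), a ∈ P.parts → a ≤ n := by
    intro P a ha
    rw [← P.parts_sum]
    exact Multiset.le_sum_of_mem ha
  have hmem : ∀ P : {P : Nat.Partition n // ∀ i ∈ P.parts, i ∈ A}, ∀ a ∈ P.1.parts, a ∈ B :=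
    fun P a ha => hB a (P.2 a ha) (P.1.parts_pos ha) (hle P.1 a ha)
  have hψ : Function.Injective ψ := by
    intro P Q h
    apply Subtype.ext
    apply Nat.Partition.ext
    ext a
    by_cases ha : a ∈ B
    · exact congrFun h ⟨a, ha⟩
    · rw [Multiset.count_eq_zero_of_notMem (fun h => ha (hmem P a h)),
        Multiset.count_eq_zero_of_notMem (fun h => ha (hmem Q a h))]
  have hsum : ∀ P : {P : Nat.Partition n // ∀ i ∈ P.parts, i ∈ A},
      ∑ a : B, ψ P a * (a : ℕ) = n := by
    intro P
    have h1 := Finset.sum_multiset_count_of_subset P.1.parts B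
      (fun a ha => hmem P a (Multiset.mem_toFinset.1 ha))
    rw [P.1.parts_sum] at h1
    have h2 := Finset.sum_coe_sort B (fun a => P.1.parts.count a * a)
    simp only [smul_eq_mul] at h1
    exact h2.trans h1.symm
  calc (restrictedPartitionCount A n : ℝ) * x ^ n
      = ∑ P : {P : Nat.Partition n // ∀ i ∈ P.parts, i ∈ A}, ∏ a : B, x ^ (ψ P a * (a : ℕ)) := by
        simp_rw [Finset.prod_pow_eq_pow_sum, hsum]
        simp [restrictedPartitionCount]
    _ = ∑ g ∈ Finset.univ.image ψ, ∏ a : B, x ^ (g a * (a : ℕ)) := by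
        rw [Finset.sum_image (fun _ _ _ _ h => hψ h)]
    _ ≤ _ := by
        apply Finset.sum_le_sum_of_subset_of_nonneg
        · intro g hg
          obtain ⟨P, _, rfl⟩ := Finset.mem_image.1 hg
          rw [Fintype.mem_piFinset]
          intro a
          rw [Finset.mem_range, Nat.lt_succ_iff]
          by_cases ha : (a : ℕ) ∈ P.1.parts
          · have h1 := Finset.single_le_sum (f := fun a : B => ψ P a * (a : ℕ))
              (fun _ _ => Nat.zero_le _) (Finset.mem_univ a)
            rw [hsum P] at h1
            exact (Nat.le_mul_of_pos_right _ (P.1.parts_pos ha)).trans h1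
          · simp [ψ, Multiset.count_eq_zero_of_notMem ha]
        · intro g _ _
          exact Finset.prod_nonneg fun a _ => pow_nonneg hx _

lemma log_restrictedPartitionCount_le {A : Set ℕ} {n : ℕ} {B : Finset ℕ}
    (hB : ∀ a ∈ A, 1 ≤ a → a ≤ n → a ∈ B) (hB0 : 0 ∉ B) {s : ℝ} (hs : 0 < s)
    (hpos : 0 < restrictedPartitionCount A n) :
    Real.log (restrictedPartitionCount A n) ≤
      n * s + ∑ a ∈ B, -Real.log (1 - Real.exp (-(s * a))) := by
  have hB1 : ∀ a ∈ B, (0 : ℝ) < a := fun a ha => by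
    have : a ≠ 0 := fun h => hB0 (h ▸ ha)
    positivity
  have hlt : ∀ a ∈ B, Real.exp (-(s * a)) < 1 := fun a ha => by
    rw [Real.exp_lt_one_iff]
    have := mul_pos hs (hB1 a ha)
    linarith
  have h1 := restrictedPartitionCount_mul_pow_le hB (Real.exp_pos (-s)).le
  have h2 : ∏ a ∈ B, ∑ k ∈ Finset.range (n + 1), Real.exp (-s) ^ (k * a) ≤
      ∏ a ∈ B, (1 - Real.exp (-(s * a)))⁻¹ := by
    apply Finset.prod_le_prod
    · intro a _
      exact Finset.sum_nonneg fun k _ => by positivity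
    · intro a ha
      have e : ∀ k, Real.exp (-s) ^ (k * a) = Real.exp (-(s * a)) ^ k := by
        intro k
        rw [← Real.exp_nat_mul, ← Real.exp_nat_mul]
        push_cast
        ring_nf
      simp_rw [e]
      rw [← tsum_geometric_of_lt_one (Real.exp_pos _).le (hlt a ha)]
      exact (summable_geometric_of_lt_one (Real.exp_pos _).le (hlt a ha)).sum_le_tsum _
        fun k _ => by positivity
  have h3 := Real.log_le_log (by positivity) (h1.trans h2)
  rw [Real.log_mul (by positivity) (by positivity), Real.log_pow, Real.log_exp,
    Real.log_prod] at h3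
  · simp_rw [Real.log_inv] at h3
    linarith
  · intro a ha
    have := hlt a ha
    exact inv_ne_zero (by linarith)

/-- The expanded product is grouped by the weight n of the multiplicity vector; distinct vectors of
weight n are distinct partitions of n. -/
lemma prod_sum_pow_le_sum_partitionCount (D K : ℕ) {x : ℝ} (hx : 0 ≤ x) :
    ∃ T : ℕ, ∏ a ∈ Finset.Icc 1 D, ∑ k ∈ Finset.range K, x ^ (k * a) ≤
      ∑ n ∈ Finset.range T, (partitionCount n : ℝ) * x ^ n := by
  classical
  rw [← Finset.prod_coe_sort, Finset.prod_univ_sum]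
  set S := Fintype.piFinset fun _ : Finset.Icc 1 D => Finset.range K with hS
  let σ : (Finset.Icc 1 D → ℕ) → ℕ := fun g => ∑ a : Finset.Icc 1 D, g a * (a : ℕ)
  refine ⟨S.sup σ + 1, ?_⟩
  have hmaps : ∀ g ∈ S, σ g ∈ Finset.range (S.sup σ + 1) := fun g hg =>
    Finset.mem_range.2 (Nat.lt_succ_of_le (Finset.le_sup hg))
  rw [← Finset.sum_fiberwise_of_maps_to hmaps]
  apply Finset.sum_le_sum
  intro n _
  have e : ∑ g ∈ S with σ g = n, ∏ a : Finset.Icc 1 D, x ^ (g a * (a : ℕ)) =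
      ∑ g ∈ S with σ g = n, x ^ n := by
    apply Finset.sum_congr rfl
    intro g hg
    rw [Finset.prod_pow_eq_pow_sum]
    exact congrArg _ (Finset.mem_filter.1 hg).2
  rw [e, Finset.sum_const, nsmul_eq_mul]
  apply mul_le_mul_of_nonneg_right _ (pow_nonneg hx _)
  rw [partitionCount_eq_restrictedPartitionCount_univ]
  exact_mod_cast finset_card_le_restrictedPartitionCount _ (multisetOfMult _)
    (multisetOfMult_injective _).injOn
    (fun g _ a ha => ⟨Set.mem_univ _, (Finset.mem_Icc.1 (mem_of_mem_multisetOfMult ha)).1⟩)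
    (fun g hg => by rw [sum_multisetOfMult]; exact (Finset.mem_filter.1 hg).2)

/-- Multiplicities at most `M` on `S₁` and an `R`-element subset of `S₂`, completed by parts `1`. -/
lemma pow_mul_choose_le_restrictedPartitionCount {A : Set ℕ} (h1A : 1 ∈ A) {S₁ S₂ : Finset ℕ}
    (hS₁ : ∀ a ∈ S₁, a ∈ A ∧ 1 < a) (hS₂ : ∀ a ∈ S₂, a ∈ A ∧ 1 < a) (hd : Disjoint S₁ S₂)
    {M R b n : ℕ} (hb : ∀ a ∈ S₂, a ≤ b) (hn : M * ∑ a ∈ S₁, a + R * b ≤ n) :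
    (M + 1) ^ S₁.card * S₂.card.choose R ≤ restrictedPartitionCount A n := by
  classical
  let base : (S₁ → ℕ) × Finset ℕ → Multiset ℕ := fun p => multisetOfMult S₁ p.1 + p.2.val
  let φ : (S₁ → ℕ) × Finset ℕ → Multiset ℕ := fun p =>
    base p + Multiset.replicate (n - (base p).sum) 1
  let T : Finset ((S₁ → ℕ) × Finset ℕ) :=
    (Fintype.piFinset fun _ : S₁ => Finset.range (M + 1)) ×ˢ Finset.powersetCard R S₂
  have hT : T.card = (M + 1) ^ S₁.card * S₂.card.choose R := by
    simp [T, Finset.card_product, Finset.card_powersetCard]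
  rw [← hT]
  have hmem : ∀ p ∈ T, (∀ a, p.1 a ≤ M) ∧ p.2 ⊆ S₂ ∧ p.2.card = R := by
    intro p hp
    simp only [T, Finset.mem_product, Fintype.mem_piFinset, Finset.mem_range,
      Finset.mem_powersetCard, Nat.lt_succ_iff] at hp
    exact hp
  have hsum : ∀ p ∈ T, (base p).sum ≤ n := by
    intro p hp
    obtain ⟨h1, h2, h3⟩ := hmem p hp
    refine le_trans ?_ hn
    simp only [base, Multiset.sum_add, sum_multisetOfMult]
    apply add_le_add
    · rw [← Finset.sum_coe_sort S₁, Finset.mul_sum]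
      exact Finset.sum_le_sum fun a _ => Nat.mul_le_mul_right _ (h1 a)
    · rw [← h3, ← smul_eq_mul]
      exact Multiset.sum_le_card_nsmul p.2.val b fun a ha => hb a (h2 ha)
  apply finset_card_le_restrictedPartitionCount T φ
  · intro p hp q hq h
    have hp' := hmem p hp
    have hq' := hmem q hq
    -- The padding consists of 1s only, and 1 lies in neither block, so all chosen multiplicities
    -- can be read off.
    have hc : ∀ a, a ≠ 1 → (base p).count a = (base q).count a := by
      intro a ha
      have := congrArg (Multiset.count a) h
      simpa [φ, Multiset.count_replicate, ha.symm] using this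
    have hz : ∀ r ∈ T, ∀ a ∈ S₁, r.2.val.count a = 0 := fun r hr a ha =>
      Multiset.count_eq_zero_of_notMem fun h' =>
        Finset.disjoint_left.1 hd ha ((hmem r hr).2.1 h')
    have hz' : ∀ r : (S₁ → ℕ) × Finset ℕ, ∀ a ∈ S₂, (multisetOfMult S₁ r.1).count a = 0 :=
      fun r a ha => Multiset.count_eq_zero_of_notMem fun h' =>
        Finset.disjoint_left.1 hd (mem_of_mem_multisetOfMult h') ha
    apply Prod.ext
    · funext a
      have := hc a (hS₁ a a.2).2.ne'
      simpa [base, hz p hp a a.2, hz q hq a a.2, count_multisetOfMult] using this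
    · ext a
      by_cases ha : a ∈ S₂
      · have := hc a (hS₂ a ha).2.ne'
        simp only [base, Multiset.count_add, hz' _ a ha, zero_add] at this
        rw [← Finset.mem_val, ← Finset.mem_val, ← Multiset.one_le_count_iff_mem, this,
          Multiset.one_le_count_iff_mem]
      · exact ⟨fun h' => absurd (hp'.2.1 h') ha, fun h' => absurd (hq'.2.1 h') ha⟩
  · intro p hp a ha
    simp only [φ, base, Multiset.mem_add] at ha
    rcases ha with (ha | ha) | ha
    · have := hS₁ a (mem_of_mem_multisetOfMult ha)
      exact ⟨this.1, by omega⟩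
    · have := hS₂ a ((hmem p hp).2.1 ha)
      exact ⟨this.1, by omega⟩
    · rw [Multiset.eq_of_mem_replicate ha]
      exact ⟨h1A, one_pos⟩
  · intro p hp
    have := hsum p hp
    simp only [φ, Multiset.sum_add, Multiset.sum_replicate, smul_eq_mul, mul_one]
    simp only [base, Multiset.sum_add] at this ⊢
    omega

lemma restrictedPartitionCount_pos {A : Set ℕ} (h1A : 1 ∈ A) (n : ℕ) :
    0 < restrictedPartitionCount A n := by
  simpa [Nat.one_le_iff_ne_zero, Nat.pos_iff_ne_zero] using
    pow_mul_choose_le_restrictedPartitionCount h1A (S₁ := ∅) (S₂ := ∅) (M := 0) (R := 0)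
    (b := 0) (n := n) (by simp) (by simp) (by simp) (by simp) (by simp)

lemma partitionCount_pos (n : ℕ) : 0 < partitionCount n := by
  rw [partitionCount_eq_restrictedPartitionCount_univ]
  exact restrictedPartitionCount_pos (Set.mem_univ _) n

lemma partitionCount_mono {m n : ℕ} (h : m ≤ n) : partitionCount m ≤ partitionCount n := by
  classical
  rw [partitionCount_eq_restrictedPartitionCount_univ n, partitionCount, Nat.card_eq_fintype_card,
    ← Finset.card_univ]
  apply finset_card_le_restrictedPartitionCount _
    (fun P : Nat.Partition m => P.parts + Multiset.replicate (n - m) 1)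
  · intro P _ Q _ h
    exact Nat.Partition.ext (add_right_cancel h)
  · intro P _ a ha
    rcases Multiset.mem_add.1 ha with ha | ha
    · exact ⟨Set.mem_univ _, P.parts_pos ha⟩
    · rw [Multiset.eq_of_mem_replicate ha]
      exact ⟨Set.mem_univ _, one_pos⟩
  · intro P _
    simp [P.parts_sum]
    omega

/-! ### Asymptotics of log p(n): upper bound. -/

lemma hasSum_one_div_succ_sq :
    HasSum (fun k : ℕ => 1 / ((k : ℝ) + 1) ^ 2) (Real.pi ^ 2 / 6) := by
  have h := (hasSum_nat_add_iff' 1).2 hasSum_zeta_two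
  simpa using h

lemma hasSum_neg_log_one_sub_exp {u : ℝ} (hu : 0 < u) :
    HasSum (fun k : ℕ => Real.exp (-((k + 1) * u)) / ((k : ℝ) + 1))
      (-Real.log (1 - Real.exp (-u))) := by
  have h1 : |Real.exp (-u)| < 1 := by
    rw [abs_of_pos (Real.exp_pos _), Real.exp_lt_one_iff]
    linarith
  convert Real.hasSum_pow_div_log_of_abs_lt_one h1 using 3 with k
  rw [← Real.exp_nat_mul]
  push_cast
  ring_nf

lemma exp_neg_mul_nat (v : ℝ) (a : ℕ) : Real.exp (-(v * a)) = Real.exp (-v) ^ a := by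
  rw [← Real.exp_nat_mul]
  ring_nf

lemma sum_Icc_pow_eq {y : ℝ} (hy : y ≠ 1) (D : ℕ) :
    ∑ a ∈ Finset.Icc 1 D, y ^ a = (y - y ^ (D + 1)) / (1 - y) := by
  have h1 : (1 - y) ≠ 0 := sub_ne_zero.2 hy.symm
  rw [eq_div_iff h1]
  induction D with
  | zero => simp
  | succ D ih =>
    rw [Finset.sum_Icc_succ_top (by omega), add_mul, ih]
    ring

lemma sum_Icc_exp_le {v : ℝ} (hv : 0 < v) (D : ℕ) :
    ∑ a ∈ Finset.Icc 1 D, Real.exp (-(v * a)) ≤ 1 / v := by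
  have hy1 : Real.exp (-v) < 1 := by
    rw [Real.exp_lt_one_iff]
    linarith
  have hy0 := Real.exp_pos (-v)
  simp_rw [exp_neg_mul_nat]
  rw [sum_Icc_pow_eq hy1.ne, div_le_div_iff₀ (by linarith) hv]
  have h2 : Real.exp (-v) * (v + 1) ≤ 1 := by
    calc Real.exp (-v) * (v + 1) ≤ Real.exp (-v) * Real.exp v :=
          mul_le_mul_of_nonneg_left (Real.add_one_le_exp v) hy0.le
      _ = 1 := by rw [← Real.exp_add]; simp
  have h3 : 0 ≤ Real.exp (-v) ^ (D + 1) * v := by positivity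
  linarith

/-- Expanding the logarithm and summing over a first bounds the k-th term by 1/(k²s), and ζ(2) =
π²/6. -/
lemma sum_neg_log_one_sub_exp_le {s : ℝ} (hs : 0 < s) (D : ℕ) :
    ∑ a ∈ Finset.Icc 1 D, -Real.log (1 - Real.exp (-(s * a))) ≤ Real.pi ^ 2 / 6 / s := by
  have h1 : HasSum (fun k : ℕ => ∑ a ∈ Finset.Icc 1 D,
      Real.exp (-((k + 1) * (s * a))) / ((k : ℝ) + 1))
      (∑ a ∈ Finset.Icc 1 D, -Real.log (1 - Real.exp (-(s * a)))) := by
    apply hasSum_sum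
    intro a ha
    have : (0 : ℝ) < a := by exact_mod_cast (Finset.mem_Icc.1 ha).1
    exact hasSum_neg_log_one_sub_exp (by positivity)
  refine hasSum_le (fun k => ?_) h1 (hasSum_one_div_succ_sq.div_const s)
  have h2 := sum_Icc_exp_le (v := (k + 1) * s) (by positivity) D
  rw [← Finset.sum_div]
  simp_rw [← mul_assoc]
  calc _ ≤ (1 / ((k + 1) * s)) / ((k : ℝ) + 1) := by gcongr
    _ = _ := by field_simp

lemma log_partitionCount_le (n : ℕ) {t : ℝ} (ht : 0 < t) :
    Real.log (partitionCount n) ≤ n * t + Real.pi ^ 2 / 6 / t := by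
  have h0 := partitionCount_pos n
  rw [partitionCount_eq_restrictedPartitionCount_univ] at h0 ⊢
  have h := log_restrictedPartitionCount_le (A := Set.univ) (n := n) (B := Finset.Icc 1 n)
    (fun a _ h1 h2 => Finset.mem_Icc.2 ⟨h1, h2⟩) (by simp) ht h0
  have := sum_neg_log_one_sub_exp_le ht n
  linarith

lemma partitionCount_le_exp (n : ℕ) {t : ℝ} (ht : 0 < t) :
    (partitionCount n : ℝ) ≤ Real.exp (n * t + Real.pi ^ 2 / 6 / t) := by
  rw [← Real.log_le_iff_le_exp (by exact_mod_cast partitionCount_pos n)]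
  exact log_partitionCount_le n ht

lemma log_partitionCount_le_sqrt (n : ℕ) :
    Real.log (partitionCount n) ≤ 2 * √(Real.pi ^ 2 / 6 * n) := by
  rcases Nat.eq_zero_or_pos n with rfl | hn
  · have h : ∀ t : ℝ, 0 < t → Real.log (partitionCount 0) ≤ Real.pi ^ 2 / 6 / t := fun t ht => by
      simpa using log_partitionCount_le 0 ht
    have hl : Tendsto (fun t : ℝ => Real.pi ^ 2 / 6 / t) atTop (𝓝 0) :=
      tendsto_const_nhds.div_atTop tendsto_id
    have := ge_of_tendsto hl ((eventually_gt_atTop 0).mono h)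
    simpa using this
  · have hn' : (0 : ℝ) < n := by exact_mod_cast hn
    set b := Real.pi ^ 2 / 6 with hb
    have hb0 : 0 < b := by positivity
    -- This t minimises nt + b/t by making both summands √(bn).
    have h := log_partitionCount_le n (t := √(b * n) / n) (by positivity)
    rw [← hb] at h
    have e1 : (n : ℝ) * (√(b * n) / n) = √(b * n) := by field_simp
    have e2 : b / (√(b * n) / n) = √(b * n) := by
      rw [div_div_eq_mul_div, div_eq_iff (by positivity), Real.mul_self_sqrt (by positivity)]
    rw [e1, e2] at h
    linarith

/-! ### Asymptotics of log p(n): lower bound by a Tauberian argument. -/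

/-- Keep K terms of the logarithmic series, with K depending on η only, and let D → ∞ for fixed s.
The k-th term becomes 1/(k(e^{ks}-1)) ≥ 1/(k²s) - 1, so the total loss K is negligible against 1/s
as s → 0. -/
lemma exists_le_sum_neg_log_one_sub_exp {η : ℝ} (hη : 0 < η) :
    ∀ᶠ s in 𝓝[>] (0 : ℝ), ∃ D : ℕ, (1 - η) * (Real.pi ^ 2 / 6) / s ≤
      ∑ a ∈ Finset.Icc 1 D, -Real.log (1 - Real.exp (-(s * a))) := by
  set b := Real.pi ^ 2 / 6 with hb
  have hb0 : 0 < b := by positivity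
  obtain ⟨K, hK⟩ : ∃ K : ℕ, (1 - η / 2) * b < ∑ k ∈ Finset.range K, 1 / ((k : ℝ) + 1) ^ 2 := by
    have := hasSum_one_div_succ_sq.tendsto_sum_nat
    have hlt : (1 - η / 2) * b < b := by nlinarith
    exact (this.eventually (lt_mem_nhds hlt)).exists
  have hs0 : 0 < η / 2 * b / (K + 1) := by positivity
  filter_upwards [Ioo_mem_nhdsGT hs0] with s hs
  obtain ⟨hs, hs1⟩ := hs
  rw [lt_div_iff₀ (by positivity)] at hs1
  have hlim : Tendsto (fun D : ℕ => ∑ k ∈ Finset.range K,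
      (∑ a ∈ Finset.Icc 1 D, Real.exp (-((k + 1) * s * a))) / ((k : ℝ) + 1)) atTop
      (𝓝 (∑ k ∈ Finset.range K, (Real.exp (-((k + 1) * s)) /
        (1 - Real.exp (-((k + 1) * s)))) / ((k : ℝ) + 1))) := by
    apply tendsto_finsetSum
    intro k _
    apply Tendsto.div_const
    have hy1 : Real.exp (-((k + 1) * s)) < 1 := by
      rw [Real.exp_lt_one_iff]
      have : 0 < (k + 1) * s := by positivity
      linarith
    simp_rw [exp_neg_mul_nat, sum_Icc_pow_eq hy1.ne]
    have h0 := (tendsto_pow_atTop_nhds_zero_of_lt_one (Real.exp_pos _).le hy1)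
    have h1 := (tendsto_const_nhds (x := Real.exp (-((k + 1) * s)))).sub
      (h0.comp (tendsto_add_atTop_nat 1))
    simpa using h1.div_const (1 - Real.exp (-((k + 1) * s)))
  have hlow : (1 - η) * b / s < ∑ k ∈ Finset.range K, (Real.exp (-((k + 1) * s)) /
        (1 - Real.exp (-((k + 1) * s)))) / ((k : ℝ) + 1) := by
    have hk : ∀ k ∈ Finset.range K, 1 / ((k : ℝ) + 1) ^ 2 / s - 1 ≤
        (Real.exp (-((k + 1) * s)) / (1 - Real.exp (-((k + 1) * s)))) / ((k : ℝ) + 1) := by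
      intro k _
      have hu : 0 < (k + 1) * s := by positivity
      have hy1 : Real.exp (-((k + 1) * s)) < 1 := by
        rw [Real.exp_lt_one_iff]
        linarith
      have hy2 := Real.add_one_le_exp (-((k + 1) * s))
      have h1 : 1 / ((k + 1) * s) - 1 ≤
          Real.exp (-((k + 1) * s)) / (1 - Real.exp (-((k + 1) * s))) := by
        have e : Real.exp (-((k + 1) * s)) / (1 - Real.exp (-((k + 1) * s))) =
            1 / (1 - Real.exp (-((k + 1) * s))) - 1 := by
          have : 1 - Real.exp (-((k + 1) * s)) ≠ 0 := by linarith
          field_simp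
          ring
        rw [e]
        have : 1 / ((k + 1) * s) ≤ 1 / (1 - Real.exp (-((k + 1) * s))) :=
          one_div_le_one_div_of_le (by linarith) (by linarith)
        linarith
      have h2 := div_le_div_of_nonneg_right h1 (show (0 : ℝ) ≤ k + 1 by positivity)
      refine le_trans ?_ h2
      rw [sub_div]
      have h3 : 1 / ((k + 1) * s) / ((k : ℝ) + 1) = 1 / ((k : ℝ) + 1) ^ 2 / s := by field_simp
      have h4 : 1 / ((k : ℝ) + 1) ≤ 1 := by
        rw [div_le_one (by positivity)]
        linarith [(Nat.cast_nonneg k : (0 : ℝ) ≤ k)]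
      linarith
    refine lt_of_lt_of_le ?_ (Finset.sum_le_sum hk)
    rw [Finset.sum_sub_distrib, ← Finset.sum_div]
    simp only [Finset.sum_const, Finset.card_range, nsmul_eq_mul, mul_one]
    have h1 : (1 - η / 2) * b / s < (∑ k ∈ Finset.range K, 1 / ((k : ℝ) + 1) ^ 2) / s := by
      gcongr
    have h2 : (K : ℝ) < η / 2 * b / s := by
      rw [lt_div_iff₀ hs]
      nlinarith
    have h3 : (1 - η) * b / s = (1 - η / 2) * b / s - η / 2 * b / s := by ring
    linarith
  obtain ⟨D, hD⟩ := (hlim.eventually (lt_mem_nhds hlow)).exists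
  refine ⟨D, hD.le.trans ?_⟩
  simp_rw [Finset.sum_div]
  rw [Finset.sum_comm]
  apply Finset.sum_le_sum
  intro a ha
  have ha0 : (0 : ℝ) < a := by exact_mod_cast (Finset.mem_Icc.1 ha).1
  have h := sum_le_hasSum (Finset.range K) (fun k _ => by positivity)
    (hasSum_neg_log_one_sub_exp (u := s * a) (by positivity))
  simpa [mul_assoc] using h

lemma exp_sum_neg_log_le {s Q : ℝ} (hs : 0 < s) (D : ℕ)
    (hQ : ∀ T : ℕ, ∑ n ∈ Finset.range T, (partitionCount n : ℝ) * Real.exp (-s) ^ n ≤ Q) :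
    Real.exp (∑ a ∈ Finset.Icc 1 D, -Real.log (1 - Real.exp (-(s * a)))) ≤ Q := by
  have hlt : ∀ a ∈ Finset.Icc 1 D, Real.exp (-(s * a)) < 1 := fun a ha => by
    rw [Real.exp_lt_one_iff]
    have : (0 : ℝ) < a := by exact_mod_cast (Finset.mem_Icc.1 ha).1
    have := mul_pos hs this
    linarith
  have hlim : Tendsto (fun K : ℕ => ∏ a ∈ Finset.Icc 1 D, ∑ k ∈ Finset.range K,
      Real.exp (-s) ^ (k * a)) atTop
      (𝓝 (∏ a ∈ Finset.Icc 1 D, (1 - Real.exp (-(s * a)))⁻¹)) := by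
    apply tendsto_finsetProd
    intro a ha
    have e : ∀ k, Real.exp (-s) ^ (k * a) = Real.exp (-(s * a)) ^ k := by
      intro k
      rw [← Real.exp_nat_mul, ← Real.exp_nat_mul]
      push_cast
      ring_nf
    simp_rw [e]
    exact (hasSum_geometric_of_lt_one (Real.exp_pos _).le (hlt a ha)).tendsto_sum_nat
  rw [Real.exp_sum]
  have e : ∏ a ∈ Finset.Icc 1 D, Real.exp (-Real.log (1 - Real.exp (-(s * a)))) =
      ∏ a ∈ Finset.Icc 1 D, (1 - Real.exp (-(s * a)))⁻¹ := by
    apply Finset.prod_congr rfl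
    intro a ha
    rw [Real.exp_neg, Real.exp_log (by linarith [hlt a ha])]
  rw [e]
  refine le_of_tendsto' hlim fun K => ?_
  obtain ⟨T, hT⟩ := prod_sum_pow_le_sum_partitionCount D K (Real.exp_pos (-s)).le
  exact hT.trans (hQ T)

/-- Splitting `∑ p(n) e^{-sn}` at `n = r` and `n = m`. -/
lemma sum_partitionCount_mul_exp_le {s δ r : ℝ} (hs : 0 < s) (hδ : 0 < δ) (hδ1 : δ < 1)
    (m T : ℕ) :
    ∑ n ∈ Finset.range T, (partitionCount n : ℝ) * Real.exp (-s) ^ n ≤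
      m * (Real.exp (Real.pi ^ 2 / 6 / ((1 + δ) * s) + δ * s * r) +
        partitionCount m * Real.exp (-(s * r))) +
      Real.exp (Real.pi ^ 2 / 6 / ((1 - δ) * s) - δ * s * m) * (1 + 1 / (δ * s)) := by
  set b := Real.pi ^ 2 / 6 with hb
  have e : ∀ n : ℕ, Real.exp (-s) ^ n = Real.exp (-(s * n)) := fun n =>
    (exp_neg_mul_nat s n).symm
  simp_rw [e]
  set G := Real.exp (b / ((1 + δ) * s) + δ * s * r) + partitionCount m * Real.exp (-(s * r))
    with hG
  have hG0 : 0 ≤ G := by positivity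
  have hδs : 0 < δ * s := by positivity
  have hsmall : ∀ n : ℕ, n < m → (partitionCount n : ℝ) * Real.exp (-(s * n)) ≤ G := by
    intro n hn
    -- Below r, bound p(n) with the larger exponent (1+δ)s. Between r and m, use monotonicity of p,
    -- which is how p(m) enters. Beyond m, the smaller exponent (1-δ)s leaves a geometric tail.
    rcases lt_or_ge (n : ℝ) r with h | h
    · have h1 := partitionCount_le_exp n (t := (1 + δ) * s) (by positivity)
      have h2 : (partitionCount n : ℝ) * Real.exp (-(s * n)) ≤
          Real.exp (b / ((1 + δ) * s) + δ * s * r) := by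
        calc _ ≤ Real.exp (n * ((1 + δ) * s) + b / ((1 + δ) * s)) * Real.exp (-(s * n)) := by
              gcongr
          _ = Real.exp (b / ((1 + δ) * s) + δ * s * n) := by
              rw [← Real.exp_add]
              ring_nf
          _ ≤ _ := by gcongr
      have : 0 ≤ partitionCount m * Real.exp (-(s * r)) := by positivity
      linarith
    · have h1 : (partitionCount n : ℝ) ≤ partitionCount m := by
        exact_mod_cast partitionCount_mono hn.le
      have h2 : (partitionCount n : ℝ) * Real.exp (-(s * n)) ≤
          partitionCount m * Real.exp (-(s * r)) := by gcongr
      have := Real.exp_pos (b / ((1 + δ) * s) + δ * s * r)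
      linarith
  have hlarge : ∀ n : ℕ, m ≤ n → (partitionCount n : ℝ) * Real.exp (-(s * n)) ≤
      Real.exp (b / ((1 - δ) * s)) * Real.exp (-(δ * s)) ^ n := by
    intro n hn
    have hd : 0 < 1 - δ := by linarith
    have h1 := partitionCount_le_exp n (t := (1 - δ) * s) (by positivity)
    calc _ ≤ Real.exp (n * ((1 - δ) * s) + b / ((1 - δ) * s)) * Real.exp (-(s * n)) := by
          gcongr
      _ = _ := by
          rw [← exp_neg_mul_nat, ← Real.exp_add, ← Real.exp_add]
          ring_nf
  have hy1 : Real.exp (-(δ * s)) < 1 := by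
    rw [Real.exp_lt_one_iff]
    linarith
  have hgeom : (1 - Real.exp (-(δ * s)))⁻¹ ≤ 1 + 1 / (δ * s) := by
    rw [inv_le_iff_one_le_mul₀ (by linarith)]
    have h2 : Real.exp (-(δ * s)) * (δ * s + 1) ≤ 1 := by
      calc _ ≤ Real.exp (-(δ * s)) * Real.exp (δ * s) :=
            mul_le_mul_of_nonneg_left (Real.add_one_le_exp _) (Real.exp_pos _).le
        _ = 1 := by rw [← Real.exp_add]; simp
    have h3 : (1 + 1 / (δ * s)) * (1 - Real.exp (-(δ * s))) =
        ((δ * s + 1) - Real.exp (-(δ * s)) * (δ * s + 1)) / (δ * s) := by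
      field_simp
    rw [h3, le_div_iff₀ hδs]
    linarith
  have hT : ∑ n ∈ Finset.range T, (partitionCount n : ℝ) * Real.exp (-(s * n)) ≤
      ∑ n ∈ Finset.range (m + T), (partitionCount n : ℝ) * Real.exp (-(s * n)) :=
    Finset.sum_le_sum_of_subset_of_nonneg (Finset.range_mono (by omega))
      fun _ _ _ => by positivity
  refine hT.trans ?_
  rw [Finset.sum_range_add]
  apply add_le_add
  · calc _ ≤ ∑ n ∈ Finset.range m, G :=
        Finset.sum_le_sum fun n hn => hsmall n (Finset.mem_range.1 hn)
      _ = m * G := by simp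
  · calc _ ≤ ∑ n ∈ Finset.range T, Real.exp (b / ((1 - δ) * s)) *
            (Real.exp (-(δ * s)) ^ m * Real.exp (-(δ * s)) ^ n) := by
          apply Finset.sum_le_sum
          intro n _
          rw [← pow_add]
          exact hlarge (m + n) (by omega)
      _ = Real.exp (b / ((1 - δ) * s) - δ * s * m) *
            ∑ n ∈ Finset.range T, Real.exp (-(δ * s)) ^ n := by
          rw [← Finset.mul_sum, ← Finset.mul_sum, ← mul_assoc, ← exp_neg_mul_nat, ← Real.exp_add]
          ring_nf
      _ ≤ _ := by
          gcongr
          refine le_trans ?_ hgeom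
          rw [← tsum_geometric_of_lt_one (Real.exp_pos _).le hy1]
          exact (summable_geometric_of_lt_one (Real.exp_pos _).le hy1).sum_le_tsum _
            fun k _ => by positivity

lemma eventually_mul_pow_le_exp (C : ℝ) (k : ℕ) {c : ℝ} (hc : 0 < c) :
    ∀ᶠ w : ℝ in atTop, C * w ^ k ≤ Real.exp (c * w) := by
  have h := (isLittleO_pow_exp_pos_mul_atTop k hc).bound (c := 1 / (|C| + 1)) (by positivity)
  filter_upwards [h, eventually_ge_atTop 0] with w hw hw0
  rw [Real.norm_of_nonneg (by positivity), Real.norm_of_nonneg (Real.exp_pos _).le,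
    div_mul_eq_mul_div, le_div_iff₀ (by positivity), one_mul] at hw
  have h1 : 0 ≤ w ^ k := by positivity
  nlinarith [le_abs_self C]

/-- With s = 1/w the sum ∑ p(n)e^{-sn} concentrates near n = bw². Cutting at a relative distance 3δ
below that point costs the exponent a fixed multiple of bw; `tail_exponent_le` does the same above
it. -/
lemma head_exponent_le {b w δ : ℝ} (hb0 : 0 < b) (hw : 0 < w) (hδ : 0 < δ) :
    b / ((1 + δ) * w⁻¹) + δ * w⁻¹ * ((1 - 3 * δ) * b * w ^ 2) ≤
      (1 - δ ^ 2 / 2) * b / w⁻¹ - δ ^ 2 * b * w := by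
  have e1 : b / ((1 + δ) * w⁻¹) = b * w * (1 / (1 + δ)) := by field_simp
  have e2 : δ * w⁻¹ * ((1 - 3 * δ) * b * w ^ 2) = b * w * (δ * (1 - 3 * δ)) := by field_simp
  have e3 : (1 - δ ^ 2 / 2) * b / w⁻¹ - δ ^ 2 * b * w =
    b * w * (1 - δ ^ 2 / 2 - δ ^ 2) := by field_simp
  rw [e1, e2, e3, ← mul_add]
  apply mul_le_mul_of_nonneg_left _ (by positivity)
  have : 1 / (1 + δ) ≤ 1 - δ + δ ^ 2 := by
    rw [div_le_iff₀ (by positivity)]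
    nlinarith [pow_pos hδ 3]
  nlinarith

lemma tail_exponent_le {b w δ : ℝ} (hb0 : 0 < b) (hw : 0 < w) (hδ : 0 < δ) (hδ1 : δ ≤ 1 / 4) :
    b / ((1 - δ) * w⁻¹) - δ * w⁻¹ * ((1 + 3 * δ) * b * w ^ 2) ≤
      (1 - δ ^ 2 / 2) * b / w⁻¹ - δ ^ 2 / 2 * b * w := by
  have hd : 0 < 1 - δ := by linarith
  have e1 : b / ((1 - δ) * w⁻¹) = b * w * (1 / (1 - δ)) := by field_simp
  have e2 : δ * w⁻¹ * ((1 + 3 * δ) * b * w ^ 2) = b * w * (δ * (1 + 3 * δ)) := by field_simp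
  have e3 : (1 - δ ^ 2 / 2) * b / w⁻¹ - δ ^ 2 / 2 * b * w =
    b * w * (1 - δ ^ 2 / 2 - δ ^ 2 / 2) := by field_simp
  rw [e1, e2, e3, ← mul_sub]
  apply mul_le_mul_of_nonneg_left _ (by positivity)
  have : 1 / (1 - δ) ≤ 1 + δ + 2 * δ ^ 2 := by
    rw [div_le_iff₀ hd]
    nlinarith [pow_pos hδ 2, pow_pos hδ 3]
  nlinarith

lemma mul_exp_le_quarter {x y c P : ℝ} (hxy : x ≤ y - c) (hP : 4 * P ≤ Real.exp c) :
    P * Real.exp x ≤ Real.exp y / 4 := by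
  have h1 := Real.exp_le_exp.2 hxy
  rw [Real.exp_sub, le_div_iff₀ (Real.exp_pos _)] at h1
  have h2 := mul_le_mul_of_nonneg_left hP (Real.exp_pos x).le
  linarith

lemma eventually_le_log_partitionCount {δ : ℝ} (hδ : 0 < δ) (hδ1 : δ ≤ 1 / 4) :
    ∀ᶠ m : ℕ in atTop, (2 - 9 * δ) * √(Real.pi ^ 2 / 6 * m) ≤ Real.log (partitionCount m) := by
  set b := Real.pi ^ 2 / 6 with hb
  have hb0 : 0 < b := by positivity
  set μ := 1 + 3 * δ with hμ
  have hμ0 : 0 < μ := by positivity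
  have key : ∀ᶠ w : ℝ in atTop, ∀ m : ℕ, (m : ℝ) = μ * b * w ^ 2 →
      (2 - 5 * δ) * (b * w) ≤ Real.log (partitionCount m) := by
    have hinv : Tendsto (fun w : ℝ => w⁻¹) atTop (𝓝[>] 0) := tendsto_inv_atTop_nhdsGT_zero
    have hc1 : 0 < δ ^ 2 * b := by positivity
    have hc2 : 0 < δ ^ 2 / 2 * b := by positivity
    have hc3 : 0 < δ * b := by positivity
    filter_upwards [hinv.eventually (exists_le_sum_neg_log_one_sub_exp
        (show 0 < δ ^ 2 / 2 by positivity)), eventually_mul_pow_le_exp (4 * (μ * b)) 2 hc1,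
      eventually_mul_pow_le_exp 8 0 hc2, eventually_mul_pow_le_exp (8 / δ) 1 hc2,
      eventually_mul_pow_le_exp (2 * (μ * b)) 2 hc3, eventually_gt_atTop 0]
      with w ⟨D, hD⟩ h1 h2 h3 h4 hw m hm
    have hs : 0 < w⁻¹ := by positivity
    have hD' := exp_sum_neg_log_le hs D (fun T =>
      sum_partitionCount_mul_exp_le (r := (1 - 3 * δ) * b * w ^ 2) hs hδ (by linarith) m T)
    have hE := (Real.exp_le_exp.2 hD).trans hD'
    rw [← hb] at hE
    set E := Real.exp ((1 - δ ^ 2 / 2) * b / w⁻¹) with hEdef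
    have x2 := tail_exponent_le hb0 hw hδ hδ1
    rw [← hμ, ← hm] at x2
    have y1 := mul_exp_le_quarter (P := m) (head_exponent_le hb0 hw hδ) (by rw [hm]; linarith)
    have y2 := mul_exp_le_quarter (P := 1 + 1 / (δ * w⁻¹)) x2 (by
      have e1 : 1 / (δ * w⁻¹) = w / δ := by field_simp
      have e2 : 8 / δ * w ^ 1 = 8 * (w / δ) := by ring
      rw [e2] at h3
      rw [e1]
      linarith)
    rw [← hEdef] at y1 y2
    have hm0 : (0 : ℝ) < m := by rw [hm]; positivity
    have hp0 : (0 : ℝ) < partitionCount m := by exact_mod_cast partitionCount_pos m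
    -- Head and tail take up at most E/4 each, so the middle range carries at least E/2.
    have y3 : E ≤ 2 * m * (partitionCount m *
        Real.exp (-(w⁻¹ * ((1 - 3 * δ) * b * w ^ 2)))) := by
      rw [mul_add] at hE
      linarith only [hE, y1, y2]
    have y4 := Real.log_le_log (Real.exp_pos _) y3
    rw [Real.log_mul (x := 2 * m) (by positivity) (by positivity),
      Real.log_mul (x := partitionCount m) (by positivity) (by positivity),
      Real.log_exp, Real.log_exp] at y4
    have y5 : Real.log (2 * m) ≤ δ * b * w := by
      rw [Real.log_le_iff_le_exp (by positivity), hm]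
      linarith
    have e1 : (1 - δ ^ 2 / 2) * b / w⁻¹ = (1 - δ ^ 2 / 2) * (b * w) := by field_simp
    have e2 : w⁻¹ * ((1 - 3 * δ) * b * w ^ 2) = (1 - 3 * δ) * (b * w) := by field_simp
    rw [e1, e2] at y4
    have hbw : 0 < b * w := by positivity
    nlinarith [mul_pos hδ hbw]
  have hw : Tendsto (fun m : ℕ => √((m : ℝ) / (μ * b))) atTop atTop :=
    Real.tendsto_sqrt_atTop.comp (tendsto_natCast_atTop_atTop.atTop_div_const (by positivity))
  filter_upwards [hw.eventually key] with m hm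
  have h1 := hm m (by rw [Real.sq_sqrt (by positivity)]; field_simp)
  refine le_trans ?_ h1
  set w := √((m : ℝ) / (μ * b)) with hwdef
  have hw0 : 0 ≤ w := Real.sqrt_nonneg _
  have h2 : √(b * m) ≤ (1 + 2 * δ) * (b * w) := by
    apply Real.sqrt_le_iff.2 ⟨by positivity, ?_⟩
    have : w ^ 2 * (μ * b) = m := by
      rw [hwdef, Real.sq_sqrt (by positivity)]
      field_simp
    have h3 : (m : ℝ) ≤ w ^ 2 * b * (1 + 2 * δ) ^ 2 := by
      rw [← this, hμ]
      have : 0 ≤ w ^ 2 * b := by positivity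
      nlinarith [sq_nonneg δ]
    have h4 := mul_le_mul_of_nonneg_left h3 hb0.le
    calc b * m ≤ _ := h4
      _ = _ := by ring
  rcases le_or_gt (2 - 9 * δ) 0 with h | h
  · have h3 : (2 - 9 * δ) * √(b * m) ≤ 0 := mul_nonpos_of_nonpos_of_nonneg h (Real.sqrt_nonneg _)
    have h4 : 0 ≤ (2 - 5 * δ) * (b * w) := mul_nonneg (by linarith) (by positivity)
    linarith
  · have h3 := mul_le_mul_of_nonneg_left h2 h.le
    have hbw : 0 ≤ b * w := by positivity
    nlinarith [mul_nonneg (sq_nonneg δ) hbw]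

/-! ### Upper bound for log p_A(n) when A is sparse up to N. -/

lemma neg_log_one_sub_exp_le_log {u : ℝ} (hu : 0 < u) :
    -Real.log (1 - Real.exp (-u)) ≤ Real.log (1 + 1 / u) := by
  have h1 : Real.exp (-u) < 1 := by
    rw [Real.exp_lt_one_iff]
    linarith
  rw [← Real.log_inv]
  apply Real.log_le_log (inv_pos.2 (by linarith))
  rw [inv_le_iff_one_le_mul₀ (by linarith)]
  have h2 : Real.exp (-u) * (u + 1) ≤ 1 := by
    calc _ ≤ Real.exp (-u) * Real.exp u :=
          mul_le_mul_of_nonneg_left (Real.add_one_le_exp _) (Real.exp_pos _).le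
      _ = 1 := by rw [← Real.exp_add]; simp
  have h3 : (1 + 1 / u) * (1 - Real.exp (-u)) = ((u + 1) - Real.exp (-u) * (u + 1)) / u := by
    field_simp
  rw [h3, le_div_iff₀ hu]
  linarith

lemma prod_Icc_one_eq_factorial (n : ℕ) : ∏ a ∈ Finset.Icc 1 n, a = n.factorial := by
  induction n with
  | zero => simp
  | succ n ih => rw [Finset.prod_Icc_succ_top (by omega), ih, Nat.factorial_succ, mul_comm]

lemma sum_log_div_le {τ : ℕ} (hτ : 1 ≤ τ) :
    ∑ a ∈ Finset.Icc 1 τ, Real.log (τ / a) ≤ τ := by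
  have hτ0 : (0 : ℝ) < τ := by exact_mod_cast hτ
  rw [← Real.log_prod]
  · rw [Finset.prod_div_distrib, Finset.prod_const, Nat.card_Icc, Nat.add_sub_cancel,
      ← Nat.cast_prod, prod_Icc_one_eq_factorial, Real.log_le_iff_le_exp (by positivity)]
    exact Real.pow_div_factorial_le_exp _ hτ0.le _
  · intro a ha
    have : (0 : ℝ) < a := by exact_mod_cast (Finset.mem_Icc.1 ha).1
    positivity

/-- Among sets of `|T|` positive integers, the sum is controlled as if all were at least `τ`. -/
lemma sum_neg_log_le_card_mul {T : Finset ℕ} (hT : 0 ∉ T) {s : ℝ} (hs : 0 < s) {τ : ℕ}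
    (hτ : 1 ≤ τ) :
    ∑ a ∈ T, -Real.log (1 - Real.exp (-(s * a))) ≤ T.card * Real.log (1 + 1 / (s * τ)) + τ := by
  classical
  have hτ0 : (0 : ℝ) < τ := by exact_mod_cast hτ
  have hT0 : ∀ a ∈ T, (0 : ℝ) < a := fun a ha => by
    have : a ≠ 0 := fun h => hT (h ▸ ha)
    positivity
  -- A part a < τ exceeds the bound at τ by at most log(τ/a); over all a ≤ τ this totals log(τ^τ/τ!)
  -- ≤ τ.
  have hterm : ∀ a ∈ T, -Real.log (1 - Real.exp (-(s * a))) ≤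
      Real.log (1 + 1 / (s * τ)) + if a < τ then Real.log (τ / a) else 0 := by
    intro a ha
    have ha0 := hT0 a ha
    refine (neg_log_one_sub_exp_le_log (mul_pos hs ha0)).trans ?_
    split_ifs with h
    · rw [← Real.log_mul (by positivity) (by positivity)]
      apply Real.log_le_log (by positivity)
      have h1 : (a : ℝ) ≤ τ := by exact_mod_cast h.le
      have h2 : (1 + 1 / (s * τ)) * ((τ : ℝ) / a) = τ / a + 1 / (s * a) := by field_simp
      rw [h2]
      gcongr
      rwa [le_div_iff₀ ha0, one_mul]
    · rw [add_zero]
      apply Real.log_le_log (by positivity)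
      have h1 : (τ : ℝ) ≤ a := by exact_mod_cast not_lt.1 h
      gcongr
  refine (Finset.sum_le_sum hterm).trans ?_
  rw [Finset.sum_add_distrib, Finset.sum_const, nsmul_eq_mul, ← Finset.sum_filter]
  gcongr
  refine le_trans ?_ (sum_log_div_le hτ)
  apply Finset.sum_le_sum_of_subset_of_nonneg
  · intro a ha
    rw [Finset.mem_filter] at ha
    have : a ≠ 0 := fun h => hT (h ▸ ha.1)
    exact Finset.mem_Icc.2 ⟨by omega, ha.2.le⟩
  · intro a ha _
    rw [Finset.mem_Icc] at ha
    apply Real.log_nonneg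
    rw [le_div_iff₀ (by exact_mod_cast ha.1), one_mul]
    exact_mod_cast ha.2

lemma sum_Ioc_neg_log_le {s : ℝ} (hs : 0 < s) {N n : ℕ} (hy : Real.exp (-(s * N)) ≤ 1 / 2) :
    ∑ a ∈ Finset.Ioc N n, -Real.log (1 - Real.exp (-(s * a))) ≤
      2 * Real.exp (-(s * N)) / s := by
  have hterm : ∀ a ∈ Finset.Ioc N n, -Real.log (1 - Real.exp (-(s * a))) ≤
      2 * Real.exp (-(s * a)) := by
    intro a ha
    have h1 : (N : ℝ) ≤ a := by exact_mod_cast (Finset.mem_Ioc.1 ha).1.le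
    have h2 : Real.exp (-(s * a)) ≤ 1 / 2 := le_trans (by gcongr) hy
    have h0 := Real.exp_pos (-(s * a))
    have h3 : 0 < 1 - Real.exp (-(s * a)) := by linarith
    have h4 := Real.one_sub_inv_le_log_of_pos h3
    have h5 : (1 - Real.exp (-(s * a)))⁻¹ ≤ 1 + 2 * Real.exp (-(s * a)) := by
      rw [inv_le_iff_one_le_mul₀ h3]
      nlinarith
    linarith
  refine (Finset.sum_le_sum hterm).trans ?_
  rw [← Finset.mul_sum, mul_div_assoc]
  apply mul_le_mul_of_nonneg_left _ zero_le_two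
  rcases le_or_gt n N with h | h
  · rw [Finset.Ioc_eq_empty (by omega), Finset.sum_empty]
    positivity
  · have e : Finset.Ioc N n = (Finset.Icc 1 (n - N)).map (addLeftEmbedding N) := by
      rw [Finset.map_add_left_Icc]
      ext a
      simp only [Finset.mem_Ioc, Finset.mem_Icc]
      omega
    rw [e, Finset.sum_map]
    have h1 : ∀ i ∈ Finset.Icc 1 (n - N), Real.exp (-(s * ((addLeftEmbedding N i : ℕ) : ℝ))) =
        Real.exp (-(s * N)) * Real.exp (-(s * i)) := by
      intro i _
      rw [← Real.exp_add, addLeftEmbedding_apply]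
      push_cast
      ring_nf
    rw [Finset.sum_congr rfl h1, ← Finset.mul_sum, div_eq_mul_one_div]
    exact mul_le_mul_of_nonneg_left (sum_Icc_exp_le hs _) (Real.exp_pos _).le

lemma log_restrictedPartitionCount_le_of_sparse {A : Set ℕ} {α β : ℝ} (hα : 0 < α)
    (hL : 1 ≤ Real.log (1 / α)) {N n : ℕ} (hN : 1 ≤ N)
    (hA : ((A ∩ Set.Icc 1 N).ncard : ℝ) ≤ β * N) (hn : (n : ℝ) ≤ α * N ^ 2)
    (hpos : 0 < restrictedPartitionCount A n) :
    Real.log (restrictedPartitionCount A n) ≤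
      α * N * Real.log (1 / α) + β * N * (Real.log (1 / α) + 1) + 3 * (α * N) + 1 := by
  classical
  set L := Real.log (1 / α) with hLdef
  have hN0 : (0 : ℝ) < N := by exact_mod_cast hN
  have hs : 0 < L / N := by positivity
  set T := (Finset.Icc 1 N).filter (· ∈ A) with hT
  have hTA : (T.card : ℝ) ≤ β * N := by
    have : A ∩ Set.Icc 1 N = (T : Set ℕ) := by
      ext a
      simp only [hT, Set.mem_inter_iff, Set.mem_Icc, Finset.coe_filter, Finset.mem_Icc,
        Set.mem_ofPred_eq]
      tauto
    rwa [this, Set.ncard_coe_finset] at hA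
  have hT0 : 0 ∉ T := by simp [hT]
  have h1 := log_restrictedPartitionCount_le (A := A) (n := n) (B := T ∪ Finset.Ioc N n)
    (fun a ha h1 h2 => by
      simp only [hT, Finset.mem_union, Finset.mem_filter, Finset.mem_Icc, Finset.mem_Ioc]
      rcases le_or_gt a N with h | h
      · exact Or.inl ⟨⟨h1, h⟩, ha⟩
      · exact Or.inr ⟨h, h2⟩) (by simp [hT]) hs hpos
  have hdisj : Disjoint T (Finset.Ioc N n) := by
    rw [Finset.disjoint_left]
    intro a ha hb
    simp only [hT, Finset.mem_filter, Finset.mem_Icc, Finset.mem_Ioc] at ha hb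
    omega
  rw [Finset.sum_union hdisj] at h1
  -- The choice s = L/N makes the factor at the cut-off N exactly α.
  have hexp : Real.exp (-(L / N * N)) = α := by
    rw [div_mul_cancel₀ _ hN0.ne', hLdef, one_div, Real.log_inv, neg_neg, Real.exp_log hα]
  have hαle : α ≤ 1 / 2 := by
    have h2 : α = Real.exp (-L) := by
      rw [hLdef, one_div, Real.log_inv, neg_neg, Real.exp_log hα]
    have h3 : Real.exp (-L) ≤ Real.exp (-1) := Real.exp_le_exp.2 (by linarith)
    have h4 := Real.exp_neg_one_lt_d9
    linarith
  have h2 := sum_Ioc_neg_log_le hs (N := N) (n := n) (by rw [hexp]; exact hαle)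
  rw [hexp] at h2
  -- With τ about αN, sτ ≥ αL ≥ α, so each part up to N costs at most log(2/α) ≤ L + 1, and the
  -- extra term τ is only O(αN).
  have hτ : 1 ≤ ⌈α * N⌉₊ := Nat.one_le_ceil_iff.2 (by positivity)
  have h3 := sum_neg_log_le_card_mul hT0 hs hτ
  have hτ1 : (⌈α * N⌉₊ : ℝ) ≤ α * N + 1 := (Nat.ceil_lt_add_one (by positivity)).le
  have hτ2 : α * N ≤ (⌈α * N⌉₊ : ℝ) := Nat.le_ceil _
  have h4 : α * L ≤ L / N * ⌈α * N⌉₊ := by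
    calc α * L = L / N * (α * N) := by field_simp
      _ ≤ _ := by gcongr
  have h5 : Real.log (1 + 1 / (L / N * ⌈α * N⌉₊)) ≤ L + 1 := by
    calc _ ≤ Real.log (2 * (1 / α)) := by
          apply Real.log_le_log (by positivity)
          have h6 : 1 / (L / N * ⌈α * N⌉₊) ≤ 1 / α := by
            apply one_div_le_one_div_of_le hα
            nlinarith
          have h7 : 1 ≤ 1 / α := by
            rw [le_div_iff₀ hα]
            linarith
          linarith
      _ = Real.log 2 + L := Real.log_mul (by norm_num) (by positivity)
      _ ≤ L + 1 := by
          have := Real.log_two_lt_d9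
          linarith
  have h6 : (n : ℝ) * (L / N) ≤ α * N * L := by
    calc (n : ℝ) * (L / N) ≤ α * N ^ 2 * (L / N) := by gcongr
      _ = _ := by field_simp
  have h7 : 2 * α / (L / N) ≤ 2 * (α * N) := by
    rw [div_div_eq_mul_div, div_le_iff₀ (by positivity)]
    have : 0 < α * N := by positivity
    nlinarith
  have h8 : T.card * Real.log (1 + 1 / (L / N * ⌈α * N⌉₊)) ≤ β * N * (L + 1) := by
    calc _ ≤ T.card * (L + 1) := by gcongr
      _ ≤ _ := by gcongr
  linarith

/-! ### From finite estimates to the lower limit; the upper bound. -/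

lemma liminfLogRatio_le_of_frequently {A : Set ℕ} {α c : ℝ}
    (h : ∃ᶠ n : ℕ in atTop, 0 < Real.log (partitionCount ⌊α * (n : ℝ)⌋₊) ∧
      (0 < restrictedPartitionCount A n → Real.log (restrictedPartitionCount A n) ≤
        c * Real.log (partitionCount ⌊α * (n : ℝ)⌋₊))) :
    liminfLogRatio A α ≤ (c : EReal) := by
  apply liminf_le_of_frequently_le'
  refine h.mono fun n ⟨h1, h2⟩ => ?_
  rcases Nat.eq_zero_or_pos (restrictedPartitionCount A n) with h0 | h0
  · rw [h0, Nat.cast_zero, ENNReal.log_zero,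
      EReal.bot_div_of_pos_ne_top (by exact_mod_cast h1) (EReal.coe_ne_top _)]
    exact bot_le
  · rw [ENNReal.log_pos_real (by exact_mod_cast h0.ne') (ENNReal.natCast_ne_top _),
      ENNReal.toReal_natCast, ← EReal.coe_div, EReal.coe_le_coe_iff, div_le_iff₀ h1]
    exact h2 h0

lemma le_liminfLogRatio_of_eventually {A : Set ℕ} {α c : ℝ}
    (h : ∀ᶠ n : ℕ in atTop, 0 < Real.log (partitionCount ⌊α * (n : ℝ)⌋₊) ∧
      0 < restrictedPartitionCount A n ∧ c * Real.log (partitionCount ⌊α * (n : ℝ)⌋₊) ≤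
        Real.log (restrictedPartitionCount A n)) :
    (c : EReal) ≤ liminfLogRatio A α := by
  apply le_liminf_of_le
  · isBoundedDefault
  refine h.mono fun n ⟨h1, h0, h2⟩ => ?_
  rw [ENNReal.log_pos_real (by exact_mod_cast h0.ne') (ENNReal.natCast_ne_top _),
    ENNReal.toReal_natCast, ← EReal.coe_div, EReal.coe_le_coe_iff, le_div_iff₀ h1]
  exact h2

lemma tendsto_floor_mul_natCast {α : ℝ} (hα : 0 < α) :
    Tendsto (fun n : ℕ => ⌊α * (n : ℝ)⌋₊) atTop atTop :=
  tendsto_nat_floor_atTop.comp (tendsto_natCast_atTop_atTop.const_mul_atTop hα)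

lemma eventually_log_partitionCount_ge_mul_sqrt {α δ : ℝ} (hα : 0 < α) (hδ : 0 < δ)
    (hδ1 : δ ≤ 1 / 10) :
    ∀ᶠ n : ℕ in atTop, (2 - 11 * δ) * √(Real.pi ^ 2 / 6 * (α * n)) ≤
      Real.log (partitionCount ⌊α * (n : ℝ)⌋₊) := by
  filter_upwards [(tendsto_floor_mul_natCast hα).eventually
    (eventually_le_log_partitionCount hδ (by linarith)),
    (tendsto_natCast_atTop_atTop.const_mul_atTop hα).eventually
      (eventually_ge_atTop (1 / δ))] with n h1 h2
  refine le_trans ?_ h1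
  have h3 : (1 - δ) * √(Real.pi ^ 2 / 6 * (α * n)) ≤
      √(Real.pi ^ 2 / 6 * (⌊α * (n : ℝ)⌋₊ : ℝ)) := by
    apply Real.le_sqrt_of_sq_le
    rw [mul_pow, Real.sq_sqrt (by positivity)]
    have h4 := (Nat.sub_one_lt_floor (α * (n : ℝ))).le
    rw [div_le_iff₀ hδ] at h2
    have h5 : (1 - δ) ^ 2 * (α * n) ≤ ⌊α * (n : ℝ)⌋₊ := by
      have : 0 ≤ α * n := by positivity
      nlinarith
    have := mul_le_mul_of_nonneg_left h5 (show 0 ≤ Real.pi ^ 2 / 6 by positivity)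
    linarith
  have h4 := mul_le_mul_of_nonneg_left h3 (show 0 ≤ 2 - 9 * δ by linarith)
  have h5 := Real.sqrt_nonneg (Real.pi ^ 2 / 6 * (α * n))
  nlinarith [mul_nonneg (sq_nonneg δ) h5]

lemma eventually_log_partitionCount_pos {α : ℝ} (hα : 0 < α) :
    ∀ᶠ n : ℕ in atTop, 0 < Real.log (partitionCount ⌊α * (n : ℝ)⌋₊) := by
  filter_upwards [eventually_log_partitionCount_ge_mul_sqrt hα (δ := 1 / 10) (by norm_num) le_rfl,
    eventually_gt_atTop 0] with n h1 h2
  have : (0 : ℝ) < n := by exact_mod_cast h2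
  refine lt_of_lt_of_le ?_ h1
  norm_num
  positivity

lemma ncard_inter_Icc_div_le_one (A : Set ℕ) (n : ℕ) :
    ((A ∩ Set.Icc 1 n).ncard : ℝ) / (n : ℝ) ≤ 1 := by
  apply div_le_one_of_le₀ _ (Nat.cast_nonneg n)
  have := Set.ncard_le_ncard (Set.inter_subset_right (s := A) (t := Set.Icc 1 n))
    (Set.finite_Icc 1 n)
  rw [← Finset.coe_Icc, Set.ncard_coe_finset, Nat.card_Icc, Nat.add_sub_cancel] at this
  exact_mod_cast this

lemma frequently_ncard_le {A : Set ℕ} {α β : ℝ} (hA : lowerDensity A = α) (h : α < β) :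
    ∃ᶠ N : ℕ in atTop, ((A ∩ Set.Icc 1 N).ncard : ℝ) ≤ β * N := by
  have hb : IsCoboundedUnder (· ≥ ·) atTop
      (fun n : ℕ => ((A ∩ Set.Icc 1 n).ncard : ℝ) / (n : ℝ)) := by
    apply IsBoundedUnder.isCoboundedUnder_ge
    exact ⟨1, eventually_map.2 (Eventually.of_forall fun n => ncard_inter_Icc_div_le_one A n)⟩
  have h1 := frequently_lt_of_liminf_lt hb (hA.trans_lt h)
  refine (h1.and_eventually (eventually_gt_atTop 0)).mono fun n ⟨h2, h3⟩ => ?_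
  rw [div_lt_iff₀ (by exact_mod_cast h3)] at h2
  exact h2.le

lemma sqrt_pi_sq_div_six_mul {x : ℝ} : √(Real.pi ^ 2 / 6 * x) = Real.pi / √6 * √x := by
  rw [Real.sqrt_mul (by positivity), Real.sqrt_div (by positivity), Real.sqrt_sq Real.pi_pos.le]

/-- A crude bound from p_A ≤ p, needed only so that the error term is finite at every α. The witness
c solves for the constant 4/√α. -/
lemma exists_liminfLogRatio_le {α : ℝ} (hα : 0 < α) (hα1 : α < 1) :
    ∃ c : ℝ, ∀ A : Set ℕ, liminfLogRatio A α ≤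
      (((1 + c) * (√6 / Real.pi) * Real.log (1 / α) : ℝ) : EReal) := by
  have hL : 0 < Real.log (1 / α) := Real.log_pos ((one_lt_div hα).2 hα1)
  have hpi := Real.pi_pos
  refine ⟨4 / √α / (√6 / Real.pi * Real.log (1 / α)) - 1, fun A => ?_⟩
  apply liminfLogRatio_le_of_frequently
  apply Eventually.frequently
  filter_upwards [eventually_log_partitionCount_ge_mul_sqrt hα (δ := 1 / 11) (by norm_num)
    (by norm_num), eventually_log_partitionCount_pos hα] with n h1 h2
  refine ⟨h2, fun h0 => ?_⟩
  have e : (1 + (4 / √α / (√6 / Real.pi * Real.log (1 / α)) - 1)) * (√6 / Real.pi) *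
      Real.log (1 / α) = 4 / √α := by
    field_simp
    ring
  rw [e]
  have h3 : Real.log (restrictedPartitionCount A n) ≤ Real.log (partitionCount n) := by
    apply Real.log_le_log (by exact_mod_cast h0)
    rw [partitionCount_eq_restrictedPartitionCount_univ]
    exact_mod_cast restrictedPartitionCount_mono (Set.subset_univ A) n
  have h4 := log_partitionCount_le_sqrt n
  have h5 : 4 / √α * √(Real.pi ^ 2 / 6 * (α * n)) = 4 * √(Real.pi ^ 2 / 6 * n) := by
    have : Real.pi ^ 2 / 6 * (α * n) = α * (Real.pi ^ 2 / 6 * n) := by ring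
    rw [this, Real.sqrt_mul hα.le]
    field_simp
  have h6 := mul_le_mul_of_nonneg_left h1 (show 0 ≤ 4 / √α by positivity)
  have h7 := Real.sqrt_nonneg (Real.pi ^ 2 / 6 * n)
  nlinarith

lemma eventually_liminfLogRatio_le {η : ℝ} (hη : 0 < η) (hη1 : η ≤ 1 / 30) :
    ∀ᶠ α in 𝓝[>] (0 : ℝ), ∀ A : Set ℕ, lowerDensity A = α → liminfLogRatio A α ≤
      (((1 + 10 * η) * (√6 / Real.pi) * Real.log (1 / α) : ℝ) : EReal) := by
  have hlog : Tendsto (fun α : ℝ => Real.log (1 / α)) (𝓝[>] 0) atTop := by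
    simp_rw [one_div]
    exact Real.tendsto_log_atTop.comp tendsto_inv_nhdsGT_zero
  filter_upwards [hlog.eventually (eventually_ge_atTop (6 / η)), self_mem_nhdsWithin]
    with α hL hα A hA
  have hα : 0 < α := hα
  have hpi := Real.pi_pos
  have hL1 : 1 ≤ Real.log (1 / α) := by
    refine le_trans ?_ hL
    rw [le_div_iff₀ hη]
    linarith
  set L := Real.log (1 / α) with hLdef
  apply liminfLogRatio_le_of_frequently
  have hfreq := frequently_ncard_le hA (show α < (1 + η) * α by nlinarith)
  have hn : Tendsto (fun N : ℕ => ⌊α * (N : ℝ) ^ 2⌋₊) atTop atTop :=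
    tendsto_nat_floor_atTop.comp
      (((tendsto_pow_atTop two_ne_zero).comp tendsto_natCast_atTop_atTop).const_mul_atTop hα)
  apply hn.frequently
  have hlarge : ∀ᶠ N : ℕ in atTop, 1 / η ≤ α * N :=
    (tendsto_natCast_atTop_atTop.const_mul_atTop hα).eventually (eventually_ge_atTop _)
  refine (hfreq.and_eventually (hlarge.and ((eventually_ge_atTop 1).and
    ((hn.eventually (eventually_log_partitionCount_pos hα)).and
    (hn.eventually (eventually_log_partitionCount_ge_mul_sqrt hα hη (by linarith))))))).mono ?_
  rintro N ⟨h1, h2, hN, h3, h4⟩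
  refine ⟨h3, fun h0 => ?_⟩
  set n := ⌊α * (N : ℝ) ^ 2⌋₊ with hndef
  have h5 := log_restrictedPartitionCount_le_of_sparse hα hL1 hN h1 (Nat.floor_le (by positivity))
    h0
  have hαN : 0 < α * N := by positivity
  rw [div_le_iff₀ hη] at h2 hL
  have h6 : α * N * (2 * (1 + η) * L) ≥
      α * N * L + (1 + η) * α * N * (L + 1) + 3 * (α * N) + 1 := by
    nlinarith
  have hαle : α ≤ 1 := by
    by_contra! h
    have : Real.log (1 / α) ≤ 0 := Real.log_nonpos (by positivity)
      ((div_le_one hα).2 h.le)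
    linarith
  have h7 : (1 - η) * (α * N) ≤ √(α * n) := by
    apply Real.le_sqrt_of_sq_le
    have h8 := (Nat.sub_one_lt_floor (α * (N : ℝ) ^ 2)).le
    rw [← hndef] at h8
    have h9 : α * (α * (N : ℝ) ^ 2 - 1) ≤ α * n := mul_le_mul_of_nonneg_left h8 hα.le
    have h10 : (1 - η) ^ 2 * (α * N) ^ 2 ≤ (α * N) ^ 2 - 1 := by
      have h11 : 1 ≤ η * (α * N) ^ 2 := by nlinarith
      nlinarith
    nlinarith
  rw [sqrt_pi_sq_div_six_mul] at h4
  have h8 : (2 - 11 * η) * (Real.pi / √6 * ((1 - η) * (α * N))) ≤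
      Real.log (partitionCount ⌊α * (n : ℝ)⌋₊) := by
    refine le_trans ?_ h4
    apply mul_le_mul_of_nonneg_left _ (by linarith)
    gcongr
  have hc : 0 ≤ (1 + 10 * η) * (√6 / Real.pi) * L := by positivity
  have h9 := mul_le_mul_of_nonneg_left h8 hc
  refine (h5.trans h6).trans (le_trans ?_ h9)
  have e : (1 + 10 * η) * (√6 / Real.pi) * L *
      ((2 - 11 * η) * (Real.pi / √6 * ((1 - η) * (α * N)))) =
      α * N * L * ((1 + 10 * η) * (2 - 11 * η) * (1 - η)) := by
    field_simp
  have e2 : α * N * (2 * (1 + η) * L) = α * N * L * (2 * (1 + η)) := by ring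
  rw [e, e2]
  apply mul_le_mul_of_nonneg_left _ (by positivity)
  nlinarith [pow_pos hη 2, pow_pos hη 3]

/-! ### One error function for all α. -/

/-- Uniformizing an error term that is eventually below every `η > 0`. -/
lemma exists_tendsto_zero_of_eventually {P : ℝ → ℝ → Prop}
    (hmono : ∀ e e' α, 0 < α → α < 1 → e ≤ e' → P e α → P e' α)
    (hex : ∀ α, 0 < α → α < 1 → ∃ e, P e α)
    (hev : ∀ η > 0, ∀ᶠ α in 𝓝[>] (0 : ℝ), P η α) :
    ∃ ε : ℝ → ℝ, Tendsto ε (𝓝[>] 0) (𝓝 0) ∧ ∀ α : ℝ, 0 < α → α < 1 → P (ε α) α := by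
  let S : ℝ → Set ℝ := fun α => {e | 0 ≤ e ∧ P e α}
  have hbdd : ∀ α, BddBelow (S α) := fun α => ⟨0, fun e he => he.1⟩
  have hnn : ∀ α, 0 ≤ sInf (S α) := fun α => Real.sInf_nonneg fun e he => he.1
  -- The infimum of admissible errors need not be attained; adding α > 0 secures an admissible value
  -- and still tends to 0.
  refine ⟨fun α => sInf (S α) + α, ?_, fun α h0 h1 => ?_⟩
  · have hS : Tendsto (fun α => sInf (S α)) (𝓝[>] 0) (𝓝 0) := by
      rw [tendsto_order]
      refine ⟨fun a ha => Eventually.of_forall fun α => ha.trans_le (hnn α), fun a ha => ?_⟩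
      filter_upwards [hev (a / 2) (by positivity)] with α h
      exact (csInf_le (hbdd α) ⟨by positivity, h⟩).trans_lt (by linarith)
    have hid : Tendsto (fun α : ℝ => α) (𝓝[>] 0) (𝓝 0) := tendsto_id.mono_left nhdsWithin_le_nhds
    simpa using hS.add hid
  · obtain ⟨e, he⟩ := hex α h0 h1
    have hne : (S α).Nonempty :=
      ⟨max e 0, le_max_right _ _, hmono _ _ _ h0 h1 (le_max_left _ _) he⟩
    obtain ⟨e', he', hlt⟩ := exists_lt_of_csInf_lt hne
      (show sInf (S α) < sInf (S α) + α by linarith)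
    exact hmono _ _ _ h0 h1 hlt.le he'.2

theorem liminfLogRatio_le_of_lowerDensity_eq : ∃ ε : ℝ → ℝ, Tendsto ε (𝓝[>] 0) (𝓝 0) ∧
      ∀ α : ℝ, 0 < α → α < 1 →
        ∀ A : Set ℕ, (∀ a ∈ A, 0 < a) → lowerDensity A = α →
          liminfLogRatio A α ≤
            (((1 + ε α) * (√6 / Real.pi) * Real.log (1 / α) : ℝ) : EReal) := by
  apply exists_tendsto_zero_of_eventually (P := fun e α => ∀ A : Set ℕ, (∀ a ∈ A, 0 < a) →
    lowerDensity A = α → liminfLogRatio A α ≤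
            (((1 + e) * (√6 / Real.pi) * Real.log (1 / α) : ℝ) : EReal))
  · intro e e' α h0 h1 he h A hA hd
    refine (h A hA hd).trans (EReal.coe_le_coe_iff.2 ?_)
    have hL : 0 ≤ Real.log (1 / α) := Real.log_nonneg ((one_le_div h0).2 h1.le)
    have := Real.pi_pos
    gcongr
  · intro α h0 h1
    obtain ⟨c, hc⟩ := exists_liminfLogRatio_le h0 h1
    exact ⟨c, fun A _ _ => hc A⟩
  · intro η hη
    filter_upwards [eventually_liminfLogRatio_le (η := min (η / 10) (1 / 30)) (by positivity)
      (min_le_right _ _), Ioo_mem_nhdsGT one_pos] with α h hα A _ hd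
    refine (h A hd).trans (EReal.coe_le_coe_iff.2 ?_)
    have hL : 0 ≤ Real.log (1 / α) := Real.log_nonneg ((one_le_div hα.1).2 hα.2.le)
    have := Real.pi_pos
    have h2 : 10 * min (η / 10) (1 / 30) ≤ η := by
      have := min_le_left (η / 10) (1 / 30)
      linarith
    gcongr

/-! ### The factorial gap set and its lower density. -/

/-- The positive integers without the gaps `(α j!, j!]`, together with `1`. -/
def factorialGapSet (α : ℝ) : Set ℕ :=
  {a | 0 < a ∧ (a = 1 ∨ ∀ j : ℕ, ¬ (α * j.factorial < a ∧ a ≤ j.factorial))}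

lemma one_mem_factorialGapSet (α : ℝ) : 1 ∈ factorialGapSet α := ⟨one_pos, Or.inl rfl⟩

lemma mem_factorialGapSet {α : ℝ} (hα : 0 < α) {a j : ℕ} (h1 : j.factorial < a)
    (h2 : (a : ℝ) ≤ α * (j + 1).factorial) : a ∈ factorialGapSet α := by
  refine ⟨by omega, Or.inr fun i ⟨h3, h4⟩ => ?_⟩
  rcases le_or_gt i j with h | h
  · have := Nat.factorial_le h
    omega
  · have h5 : ((j + 1).factorial : ℝ) ≤ i.factorial := by
      exact_mod_cast Nat.factorial_le (show j + 1 ≤ i from h)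
    have := mul_le_mul_of_nonneg_left h5 hα.le
    linarith

lemma exists_factorial_le_lt {J : ℕ} {x : ℝ} (hJ : (J.factorial : ℝ) ≤ x) :
    ∃ j, J ≤ j ∧ (j.factorial : ℝ) ≤ x ∧ x < (j + 1).factorial := by
  classical
  have hex : ∃ k : ℕ, x < k.factorial := by
    obtain ⟨k, hk⟩ := exists_nat_gt x
    exact ⟨k, hk.trans_le (by exact_mod_cast Nat.self_le_factorial k)⟩
  have h1 := Nat.find_spec hex
  set k := Nat.find hex with hk
  have hJk : J < k := by
    by_contra! h
    have : (k.factorial : ℝ) ≤ J.factorial := by exact_mod_cast Nat.factorial_le h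
    linarith
  obtain ⟨j, hj⟩ : ∃ j, k = j + 1 := ⟨k - 1, by omega⟩
  refine ⟨j, by omega, ?_, hj ▸ h1⟩
  have := Nat.find_min hex (m := j) (by omega)
  linarith

lemma ncard_factorialGapSet_le {α : ℝ} (hα : 0 < α) (j : ℕ) :
    ((factorialGapSet α ∩ Set.Icc 1 j.factorial).ncard : ℝ) ≤ α * j.factorial + 1 := by
  have hsub : factorialGapSet α ∩ Set.Icc 1 j.factorial ⊆
      ((insert 1 (Finset.Icc 1 ⌊α * j.factorial⌋₊) : Finset ℕ) : Set ℕ) := by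
    rintro a ⟨⟨h0, h1⟩, h2⟩
    simp only [Finset.coe_insert, Finset.coe_Icc, Set.mem_insert_iff, Set.mem_Icc]
    refine h1.imp id fun h => ⟨h0, Nat.le_floor ?_⟩
    by_contra! h3
    exact h j ⟨h3, h2.2⟩
  have h1 := Set.ncard_le_ncard hsub (Finset.finite_toSet _)
  rw [Set.ncard_coe_finset] at h1
  have h2 := h1.trans (Finset.card_insert_le _ _)
  rw [Nat.card_Icc, Nat.add_sub_cancel] at h2
  have h3 : ((factorialGapSet α ∩ Set.Icc 1 j.factorial).ncard : ℝ) ≤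
      ⌊α * (j.factorial : ℝ)⌋₊ + 1 := by exact_mod_cast h2
  have := Nat.floor_le (show 0 ≤ α * (j.factorial : ℝ) by positivity)
  linarith

lemma le_card_Ioc_floor {x y : ℝ} {m : ℕ} (hx : (m : ℝ) ≤ x) :
    y - 1 - x ≤ (Finset.Ioc m ⌊y⌋₊).card := by
  rw [Nat.card_Ioc]
  have h1 := (Nat.sub_one_lt_floor y).le
  have h2 : (⌊y⌋₊ : ℝ) ≤ ((⌊y⌋₊ - m : ℕ) : ℝ) + m := by
    exact_mod_cast le_tsub_add
  linarith

/-- Only the last one or two blocks (j!, α(j+1)!] are counted. The integers below them number at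
most i! or (i+1)!, which is negligible: in the second case n > α(i+2)!, whence the α in the
denominator. -/
lemma le_ncard_factorialGapSet {α : ℝ} (hα : 0 < α) (hα1 : α < 1) {i n : ℕ}
    (h1 : (i + 1).factorial ≤ n) (h2 : n < (i + 2).factorial) :
    α * n - 1 - n / (α * (i + 1)) ≤ ((factorialGapSet α ∩ Set.Icc 1 n).ncard : ℝ) := by
  have hn0 : (0 : ℝ) ≤ n := Nat.cast_nonneg n
  have h1' : ((i + 1).factorial : ℝ) ≤ n := by exact_mod_cast h1
  have h2' : (n : ℝ) ≤ (i + 2).factorial := by exact_mod_cast h2.le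
  have hf1 : ((i + 1).factorial : ℝ) = (i + 1) * i.factorial := by
    rw [Nat.factorial_succ]
    push_cast
    ring
  have hf2 : ((i + 2).factorial : ℝ) = (i + 2) * (i + 1).factorial := by
    rw [Nat.factorial_succ]
    push_cast
    ring
  have hfin : (factorialGapSet α ∩ Set.Icc 1 n).Finite := (Set.finite_Icc 1 n).inter_of_right _
  have hsub : ∀ S : Finset ℕ, (∀ a ∈ S, a ∈ factorialGapSet α ∧ a ≤ n) →
      (S.card : ℝ) ≤ ((factorialGapSet α ∩ Set.Icc 1 n).ncard : ℝ) := by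
    intro S hS
    have h := Set.ncard_le_ncard (s := (S : Set ℕ)) (t := factorialGapSet α ∩ Set.Icc 1 n)
      (fun a ha => ⟨(hS a ha).1, (hS a ha).1.1, (hS a ha).2⟩) hfin
    rw [Set.ncard_coe_finset] at h
    exact_mod_cast h
  rcases le_or_gt (n : ℝ) (α * (i + 2).factorial) with h | h
  · have hle : ⌊α * ((i + 1).factorial : ℝ)⌋₊ ≤ (i + 1).factorial := by
      apply Nat.floor_le_of_le
      have : (0 : ℝ) ≤ (i + 1).factorial := Nat.cast_nonneg _
      nlinarith
    have hS := hsub (Finset.Ioc i.factorial ⌊α * ((i + 1).factorial : ℝ)⌋₊ ∪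
      Finset.Ioc (i + 1).factorial n) (fun a ha => by
        rcases Finset.mem_union.1 ha with ha | ha
        · rw [Finset.mem_Ioc] at ha
          refine ⟨mem_factorialGapSet hα ha.1 ?_, by omega⟩
          exact (Nat.le_floor_iff (by positivity)).1 ha.2
        · rw [Finset.mem_Ioc] at ha
          refine ⟨mem_factorialGapSet hα ha.1 ?_, ha.2⟩
          exact le_trans (by exact_mod_cast ha.2) h)
    rw [Finset.card_union_of_disjoint (by
      rw [Finset.disjoint_left]
      intro a ha hb
      rw [Finset.mem_Ioc] at ha hb
      omega)] at hS
    push_cast at hS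
    have h3 := le_card_Ioc_floor (m := i.factorial) (y := α * ((i + 1).factorial : ℝ)) le_rfl
    have h4 : ((Finset.Ioc (i + 1).factorial n).card : ℝ) = n - (i + 1).factorial := by
      rw [Nat.card_Ioc, Nat.cast_sub h1]
    have h5 : (i.factorial : ℝ) ≤ n / (α * (i + 1)) := by
      rw [le_div_iff₀ (by positivity)]
      have : (0 : ℝ) ≤ (i + 1).factorial := Nat.cast_nonneg _
      nlinarith
    have h6 : α * (n - (i + 1).factorial) ≤ n - (i + 1).factorial := by
      have : (0 : ℝ) ≤ n - (i + 1).factorial := by linarith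
      nlinarith
    linarith
  · have hS := hsub (Finset.Ioc (i + 1).factorial ⌊α * ((i + 2).factorial : ℝ)⌋₊) (fun a ha => by
      rw [Finset.mem_Ioc] at ha
      have h3 := (Nat.le_floor_iff (by positivity)).1 ha.2
      exact ⟨mem_factorialGapSet hα ha.1 h3, by exact_mod_cast h3.trans h.le⟩)
    have h3 := le_card_Ioc_floor (m := (i + 1).factorial) (y := α * ((i + 2).factorial : ℝ)) le_rfl
    have h5 : ((i + 1).factorial : ℝ) ≤ n / (α * (i + 1)) := by
      rw [le_div_iff₀ (by positivity)]
      have : (0 : ℝ) ≤ α * (i + 1).factorial := by positivity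
      nlinarith
    have h6 := mul_le_mul_of_nonneg_left h2' hα.le
    linarith

lemma lowerDensity_factorialGapSet {α : ℝ} (hα : 0 < α) (hα1 : α < 1) :
    lowerDensity (factorialGapSet α) = α := by
  set u : ℕ → ℝ := fun n => ((factorialGapSet α ∩ Set.Icc 1 n).ncard : ℝ) / (n : ℝ) with hu
  have hbdd : IsBoundedUnder (· ≥ ·) atTop u :=
    ⟨0, eventually_map.2 (Eventually.of_forall fun n => by positivity)⟩
  have hcobdd : IsCoboundedUnder (· ≥ ·) atTop u := by
    apply IsBoundedUnder.isCoboundedUnder_ge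
    exact ⟨1, eventually_map.2 (Eventually.of_forall fun n => ncard_inter_Icc_div_le_one _ n)⟩
  have hfac : Tendsto Nat.factorial atTop atTop :=
    tendsto_atTop_mono Nat.self_le_factorial tendsto_id
  apply le_antisymm
  · apply le_of_forall_pos_le_add
    intro δ hδ
    apply liminf_le_of_frequently_le _ hbdd
    apply hfac.frequently
    apply Eventually.frequently
    filter_upwards [(tendsto_natCast_atTop_atTop.comp hfac).eventually
      (eventually_ge_atTop (1 / δ))] with j hj
    have hj0 : (0 : ℝ) < j.factorial := by positivity
    simp only [hu, Function.comp_apply] at hj ⊢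
    rw [div_le_iff₀ hj0]
    rw [div_le_iff₀ hδ] at hj
    have := ncard_factorialGapSet_le hα j
    linarith
  · apply le_of_forall_pos_sub_le
    intro δ hδ
    apply le_liminf_of_le hcobdd
    obtain ⟨J, hJ⟩ := exists_nat_ge (2 / (δ * α))
    filter_upwards [eventually_ge_atTop (J + 1).factorial,
      tendsto_natCast_atTop_atTop.eventually (eventually_ge_atTop (2 / δ))] with n h1 h2
    obtain ⟨j, hj, hj1, hj2⟩ := exists_factorial_le_lt (J := J + 1) (x := n) (by exact_mod_cast h1)
    obtain ⟨i, rfl⟩ : ∃ i, j = i + 1 := ⟨j - 1, by omega⟩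
    have h3 := le_ncard_factorialGapSet hα hα1 (by exact_mod_cast hj1) (by exact_mod_cast hj2)
    have hn0 : (0 : ℝ) < n := lt_of_lt_of_le (by positivity) h2
    have hJi : (J : ℝ) ≤ i := by exact_mod_cast (by omega : J ≤ i)
    have h4 : (n : ℝ) / (α * (i + 1)) ≤ δ / 2 * n := by
      rw [div_le_iff₀ (by positivity)]
      rw [div_le_iff₀ (by positivity)] at hJ
      have h5 : 2 ≤ (i + 1) * (δ * α) := by
        have : 0 < δ * α := by positivity
        nlinarith
      nlinarith
    rw [div_le_iff₀ hδ] at h2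
    simp only [hu]
    rw [le_div_iff₀ hn0]
    linarith

/-! ### Constructing many partitions; the lower bound. -/

/-- Multiplicities of the small parts in `(θαN, αN]`. -/
lemma exists_small_block {α θ N X : ℝ} {n : ℕ} (hα : 0 < α) (hθ : 0 < θ) (hθ1 : θ ≤ 1 / 10)
    (hL : Real.log (32 / θ) ≤ θ * Real.log (1 / α)) (hL0 : 0 ≤ Real.log (1 / α))
    (hX : 0 < X) (hn : (n : ℝ) = α * X ^ 2)
    (hN1 : X / 4 ≤ N) (hN2 : N ≤ 4 * X) (hlarge : 1 ≤ θ * (α * N)) :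
    ∃ (S : Finset ℕ) (M : ℕ), (∀ a ∈ S, θ * (α * N) < a ∧ (a : ℝ) ≤ α * N ∧ 1 < a) ∧
      (M : ℝ) * ((∑ a ∈ S, a : ℕ) : ℝ) ≤ θ * n ∧
      (1 - 4 * θ) * Real.log (1 / α) * (α * N) ≤ Real.log ((M + 1 : ℝ) ^ S.card) := by
  set L := Real.log (1 / α) with hLdef
  have hN0 : 0 < N := by linarith
  have hαN : 0 < α * N := by positivity
  -- The block has at most αN parts of size at most αN, so multiplicities up to M use at most θn;
  -- the other (1-θ)n is left for large parts.
  set M := ⌊θ * n / (α * N) ^ 2⌋₊ with hM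
  have hmem : ∀ a ∈ Finset.Ioc ⌊θ * (α * N)⌋₊ ⌊α * N⌋₊,
      θ * (α * N) < a ∧ (a : ℝ) ≤ α * N := by
    intro a ha
    rw [Finset.mem_Ioc] at ha
    exact ⟨(Nat.floor_lt (by positivity)).1 ha.1, (Nat.le_floor_iff hαN.le).1 ha.2⟩
  refine ⟨Finset.Ioc ⌊θ * (α * N)⌋₊ ⌊α * N⌋₊, M, fun a ha => ⟨(hmem a ha).1, (hmem a ha).2, ?_⟩,
    ?_, ?_⟩
  · have := (hmem a ha).1
    exact_mod_cast lt_of_le_of_lt hlarge this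
  · have h1 : ((∑ a ∈ Finset.Ioc ⌊θ * (α * N)⌋₊ ⌊α * N⌋₊, a : ℕ) : ℝ) ≤ (α * N) ^ 2 := by
      push_cast
      have h2 := Finset.sum_le_card_nsmul _ (fun a : ℕ => (a : ℝ)) (α * N)
        (fun a ha => (hmem a ha).2)
      refine h2.trans ?_
      rw [nsmul_eq_mul, sq]
      apply mul_le_mul_of_nonneg_right _ hαN.le
      rw [Nat.card_Ioc]
      exact le_trans (by exact_mod_cast Nat.sub_le _ _) (Nat.floor_le hαN.le)
    have h2 : (M : ℝ) ≤ θ * n / (α * N) ^ 2 := Nat.floor_le (by positivity)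
    calc _ ≤ θ * n / (α * N) ^ 2 * (α * N) ^ 2 := by gcongr
      _ = θ * n := by field_simp
  · rw [Real.log_pow]
    have h1 : (1 - 2 * θ) * (α * N) ≤ (Finset.Ioc ⌊θ * (α * N)⌋₊ ⌊α * N⌋₊).card := by
      have := le_card_Ioc_floor (y := α * N) (Nat.floor_le (show 0 ≤ θ * (α * N) by positivity))
      linarith
    have h2 : (1 - θ) * L ≤ Real.log (M + 1) := by
      -- N ≤ 4X gives n/(αN)² ≥ 1/(16α). The constant 32 is the one required by the large block.
      have h3 : 1 / α / (32 / θ) ≤ (M : ℝ) + 1 := by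
        have h4 := (Nat.lt_floor_add_one (θ * n / (α * N) ^ 2)).le
        rw [← hM] at h4
        refine le_trans ?_ h4
        have e : 1 / α / (32 / θ) = θ / (32 * α) := by field_simp
        rw [e, hn, div_le_div_iff₀ (by positivity) (by positivity)]
        have h5 : N ^ 2 ≤ 16 * X ^ 2 := by nlinarith
        have h6 : 0 ≤ θ * α ^ 2 := by positivity
        nlinarith [mul_le_mul_of_nonneg_left h5 h6, mul_nonneg h6 (sq_nonneg X)]
      have h4 := Real.log_le_log (by positivity) h3
      rw [Real.log_div (by positivity) (by positivity)] at h4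
      linarith
    have h3 : (1 - 2 * θ) * (α * N) * ((1 - θ) * L) ≤
        (Finset.Ioc ⌊θ * (α * N)⌋₊ ⌊α * N⌋₊).card * Real.log (M + 1) := by
      apply mul_le_mul h1 h2 (mul_nonneg (by linarith) hL0) (Nat.cast_nonneg _)
    refine le_trans ?_ h3
    have e1 : (1 - 4 * θ) * L * (α * N) = L * (α * N) * (1 - 4 * θ) := by ring
    have e2 : (1 - 2 * θ) * (α * N) * ((1 - θ) * L) = L * (α * N) * ((1 - 2 * θ) * (1 - θ)) := by
      ring
    rw [e1, e2]
    apply mul_le_mul_of_nonneg_left _ (by positivity)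
    nlinarith

/-- Sets of large parts in `(N, (1 + θ)N]`. -/
lemma exists_large_block {α θ N X : ℝ} {n : ℕ} (hα : 0 < α) (hθ : 0 < θ) (hθ1 : θ ≤ 1 / 10)
    (hαθ : α ≤ θ / 64)
    (hL : Real.log (32 / θ) ≤ θ * Real.log (1 / α)) (hL0 : 0 ≤ Real.log (1 / α))
    (hX : 0 < X) (hn : (n : ℝ) = α * X ^ 2)
    (hN1 : X / 4 ≤ N) (hN2 : N ≤ 4 * X) (hlarge : 4 ≤ θ * (α * X)) :
    ∃ (S : Finset ℕ) (R b : ℕ), (∀ a ∈ S, N < a ∧ (a : ℝ) ≤ (1 + θ) * N ∧ 1 < a ∧ a ≤ b) ∧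
      (R : ℝ) * b ≤ (1 - θ) * n ∧ 0 < S.card.choose R ∧
      (1 - 4 * θ) * Real.log (1 / α) * (n / N) ≤ Real.log (S.card.choose R) := by
  set L := Real.log (1 / α) with hLdef
  have hN0 : 0 < N := by linarith
  set R := ⌊(1 - θ) * n / ((1 + θ) * N)⌋₊ with hR
  have h1θ : 0 < 1 - θ := by linarith
  have hmem : ∀ a ∈ Finset.Ioc ⌊N⌋₊ ⌊(1 + θ) * N⌋₊, N < a ∧ (a : ℝ) ≤ (1 + θ) * N := by
    intro a ha
    rw [Finset.mem_Ioc] at ha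
    exact ⟨(Nat.floor_lt hN0.le).1 ha.1, (Nat.le_floor_iff (by positivity)).1 ha.2⟩
  have hX1 : 4 * 64 * 10 ≤ X := by
    have h1 : θ * (α * X) ≤ 1 / 10 * (1 / 640 * X) := by
      have : α ≤ 1 / 640 := by linarith
      gcongr
    linarith
  have hN1' : 1 ≤ N := by linarith
  set S := Finset.Ioc ⌊N⌋₊ ⌊(1 + θ) * N⌋₊ with hS
  have hnN : (n : ℝ) / N ≤ 16 * (α * N) := by
    rw [hn, div_le_iff₀ hN0]
    have : X ^ 2 ≤ 16 * N ^ 2 := by nlinarith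
    have := mul_le_mul_of_nonneg_left this hα.le
    linarith
  have hn0 : (0 : ℝ) < n := by rw [hn]; positivity
  have hquot : (1 - θ) * n / ((1 + θ) * N) ≤ n / N := by
    rw [div_le_div_iff₀ (by positivity) hN0]
    have : 0 < n * N := by positivity
    nlinarith
  have hR1 : (R : ℝ) ≤ 16 * (α * N) :=
    (Nat.floor_le (by positivity)).trans (hquot.trans hnN)
  have hR2 : (1 - 3 * θ) * (n / N) ≤ R := by
    have h1 := (Nat.sub_one_lt_floor ((1 - θ) * n / ((1 + θ) * N))).le
    rw [← hR] at h1
    have h2 : (1 - 2 * θ) * (n / N) ≤ (1 - θ) * n / ((1 + θ) * N) := by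
      have e : (1 - θ) * n / ((1 + θ) * N) = (1 - θ) / (1 + θ) * (n / N) := by field_simp
      rw [e]
      apply mul_le_mul_of_nonneg_right _ (by positivity)
      rw [le_div_iff₀ (by positivity)]
      nlinarith
    have h3 : 1 ≤ θ * (n / N) := by
      rw [hn, ← mul_div_assoc, le_div_iff₀ hN0]
      nlinarith
    linarith
  have hcard : θ * N - 1 ≤ S.card := by
    have := le_card_Ioc_floor (y := (1 + θ) * N) (Nat.floor_le hN0.le)
    rw [← hS] at this
    linarith
  have hcard2 : θ * N / 2 ≤ ((S.card + 1 - R : ℕ) : ℝ) := by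
    have h1 : ((S.card + 1 : ℕ) : ℝ) ≤ ((S.card + 1 - R : ℕ) : ℝ) + R := by
      exact_mod_cast le_tsub_add
    push_cast at h1
    have h2 : 16 * (α * N) ≤ 1 / 4 * (θ * N) := by nlinarith
    have h3 : 0 < θ * N := by positivity
    linarith
  have hR0 : 0 < (R : ℝ) := lt_of_lt_of_le (mul_pos (by linarith) (by positivity)) hR2
  -- The binomial is at least ((|S|+1-R)/R)^R, and the bounds θN/2 and 16αN have quotient θ/(32α).
  have hchoose : (1 / α / (32 / θ)) ^ R ≤ (S.card.choose R : ℝ) := by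
    refine le_trans ?_ (Nat.pow_le_choose R S.card)
    rw [le_div_iff₀ (by positivity)]
    have h1 : (R.factorial : ℝ) ≤ (R : ℝ) ^ R := by exact_mod_cast Nat.factorial_le_pow R
    calc (1 / α / (32 / θ)) ^ R * (R.factorial : ℝ) ≤ (1 / α / (32 / θ)) ^ R * (R : ℝ) ^ R := by
          gcongr
      _ = (1 / α / (32 / θ) * R) ^ R := by rw [mul_pow]
      _ ≤ _ := by
          have h2 : 1 / α / (32 / θ) * R ≤ ((S.card + 1 - R : ℕ) : ℝ) := by
            refine le_trans ?_ hcard2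
            calc _ ≤ 1 / α / (32 / θ) * (16 * (α * N)) := by gcongr
              _ = _ := by
                field_simp
                norm_num
          have h3 := pow_le_pow_left₀ (by positivity) h2 R
          exact_mod_cast h3
  have hpos : (0 : ℝ) < (1 / α / (32 / θ)) ^ R := by positivity
  refine ⟨S, R, ⌊(1 + θ) * N⌋₊, fun a ha => ⟨(hmem a ha).1, (hmem a ha).2, ?_,
    (Finset.mem_Ioc.1 ha).2⟩, ?_, by exact_mod_cast lt_of_lt_of_le hpos hchoose, ?_⟩
  · exact_mod_cast lt_of_le_of_lt hN1' (hmem a ha).1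
  · calc (R : ℝ) * ⌊(1 + θ) * N⌋₊ ≤ (1 - θ) * n / ((1 + θ) * N) * ((1 + θ) * N) := by
          gcongr
          · exact Nat.floor_le (by positivity)
          · exact Nat.floor_le (by positivity)
      _ = _ := by field_simp
  · have h1 := Real.log_le_log hpos hchoose
    rw [Real.log_pow, Real.log_div (by positivity) (by positivity)] at h1
    refine le_trans ?_ h1
    have h2 : (1 - θ) * L ≤ L - Real.log (32 / θ) := by linarith
    have h3 : (1 - 3 * θ) * (n / N) * ((1 - θ) * L) ≤ R * (L - Real.log (32 / θ)) :=
      mul_le_mul hR2 h2 (mul_nonneg h1θ.le hL0) hR0.le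
    refine le_trans ?_ h3
    have e1 : (1 - 4 * θ) * L * (n / N) = L * (n / N) * (1 - 4 * θ) := by ring
    have e2 : (1 - 3 * θ) * (n / N) * ((1 - θ) * L) = L * (n / N) * ((1 - 3 * θ) * (1 - θ)) := by
      ring
    rw [e1, e2]
    apply mul_le_mul_of_nonneg_left _ (by positivity)
    nlinarith

lemma le_log_restrictedPartitionCount_of_blocks {A : Set ℕ} {α θ X N : ℝ} {n : ℕ} (hα : 0 < α)
    (hθ : 0 < θ) (hθ1 : θ ≤ 1 / 10) (hαθ : α ≤ θ / 64)
    (hL : Real.log (32 / θ) ≤ θ * Real.log (1 / α)) (hX : 0 < X) (hn : (n : ℝ) = α * X ^ 2)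
    (hlarge : 4 ≤ θ * (α * X)) (h1A : 1 ∈ A) (hN1 : X / 4 ≤ N) (hN2 : N ≤ 4 * X)
    (hθN : 1 ≤ θ * (α * N)) (hA₁ : ∀ a : ℕ, θ * (α * N) < a → (a : ℝ) ≤ α * N → a ∈ A)
    (hA₂ : ∀ a : ℕ, N < a → (a : ℝ) ≤ (1 + θ) * N → a ∈ A) :
    (1 - 4 * θ) * Real.log (1 / α) * (2 * (α * X)) ≤
      Real.log (restrictedPartitionCount A n) := by
  have hN0 : 0 < N := by linarith
  have hL0 : 0 ≤ Real.log (1 / α) := by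
    apply Real.log_nonneg
    rw [le_div_iff₀ hα]
    linarith
  have hc0 : 0 ≤ (1 - 4 * θ) * Real.log (1 / α) := mul_nonneg (by linarith) hL0
  obtain ⟨S₁, M, hS₁, hM, hlog₁⟩ := exists_small_block hα hθ hθ1 hL hL0 hX hn hN1 hN2 hθN
  obtain ⟨S₂, R, b, hS₂, hR, hch, hlog₂⟩ :=
    exists_large_block hα hθ hθ1 hαθ hL hL0 hX hn hN1 hN2 hlarge
  have hcount := pow_mul_choose_le_restrictedPartitionCount h1A (S₁ := S₁) (S₂ := S₂)
    (M := M) (R := R) (b := b) (n := n)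
    (fun a ha => ⟨hA₁ a (hS₁ a ha).1 (hS₁ a ha).2.1, (hS₁ a ha).2.2⟩)
    (fun a ha => ⟨hA₂ a (hS₂ a ha).1 (hS₂ a ha).2.1, (hS₂ a ha).2.2.1⟩) (by
      rw [Finset.disjoint_left]
      intro a ha hb
      have h1 := (hS₁ a ha).2.1
      have h2 := (hS₂ a hb).1
      have h3 : α * N ≤ 1 * N := by
        gcongr
        linarith
      linarith) (fun a ha => (hS₂ a ha).2.2.2) (by
      have : (M : ℝ) * ((∑ a ∈ S₁, a : ℕ) : ℝ) + R * b ≤ n := by linarith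
      exact_mod_cast this)
  have hcount' : ((M + 1 : ℝ) ^ S₁.card * S₂.card.choose R) ≤ restrictedPartitionCount A n := by
    exact_mod_cast hcount
  have hch' : (0 : ℝ) < S₂.card.choose R := by exact_mod_cast hch
  have hlog := Real.log_le_log (by positivity) hcount'
  rw [Real.log_mul (by positivity) hch'.ne'] at hlog
  -- AM-GM, since αN · (n/N) = αn = (αX)².
  have hamgm : 2 * (α * X) ≤ α * N + n / N := by
    have e : α * N + n / N - 2 * (α * X) = α * (N - X) ^ 2 / N := by
      rw [hn]
      field_simp
      ring
    have : 0 ≤ α * (N - X) ^ 2 / N := by positivity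
    linarith
  have := mul_le_mul_of_nonneg_left hamgm hc0
  rw [mul_add] at this
  linarith

/-- Let (i+1)! be the last factorial up to 4X. The hypothesis on J makes ratios of consecutive
factorials exceed 1/(θα²), so that the blocks used fit between gaps. -/
lemma le_log_restrictedPartitionCount_factorialGapSet {α θ X : ℝ} {n J : ℕ} (hα : 0 < α)
    (hθ : 0 < θ) (hθ1 : θ ≤ 1 / 10) (hαθ : α ≤ θ / 64)
    (hL : Real.log (32 / θ) ≤ θ * Real.log (1 / α)) (hX : 0 < X) (hn : (n : ℝ) = α * X ^ 2)
    (hlarge : 4 ≤ θ * (α * X)) (hJ : 1 ≤ J * (θ * α ^ 2)) (hJX : ((J + 1).factorial : ℝ) ≤ 4 * X) :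
    (1 - 4 * θ) * Real.log (1 / α) * (2 * (α * X)) ≤
      Real.log (restrictedPartitionCount (factorialGapSet α) n) := by
  set L := Real.log (1 / α) with hLdef
  have hα1 : α ≤ 1 / 640 := by linarith
  have hL0 : 0 ≤ L := by
    apply Real.log_nonneg
    rw [le_div_iff₀ hα]
    linarith
  have hc0 : 0 ≤ (1 - 4 * θ) * L := mul_nonneg (by linarith) hL0
  have h1A := one_mem_factorialGapSet α
  have hαX : 0 < α * X := by positivity
  obtain ⟨j, hj, hj1, hj2⟩ := exists_factorial_le_lt hJX
  obtain ⟨i, rfl⟩ : ∃ i, j = i + 1 := ⟨j - 1, by omega⟩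
  have hJi : (J : ℝ) ≤ i := by exact_mod_cast (by omega : J ≤ i)
  have hi : 1 ≤ i * (θ * α ^ 2) := hJ.trans (by gcongr)
  have hi1 : 1 ≤ i * (θ * α) := by
    refine hi.trans ?_
    have : θ * α ^ 2 ≤ θ * α := by nlinarith [mul_pos hθ hα]
    gcongr
  have hi2 : 2 ≤ i * α := by
    have h1 : 0 ≤ i * α := by positivity
    nlinarith
  have hf1 : ((i + 1).factorial : ℝ) = (i + 1) * i.factorial := by
    rw [Nat.factorial_succ]
    push_cast
    ring
  have hf2 : ((i + 2).factorial : ℝ) = (i + 2) * (i + 1).factorial := by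
    rw [Nat.factorial_succ]
    push_cast
    ring
  have hlogle : ∀ k : ℕ, 0 < k → k ≤ restrictedPartitionCount (factorialGapSet α) n →
      Real.log k ≤ Real.log (restrictedPartitionCount (factorialGapSet α) n) :=
    fun k hk0 hk => Real.log_le_log (by exact_mod_cast hk0) (by exact_mod_cast hk)
  rcases le_or_gt (X / 4) ((i + 1).factorial : ℝ) with h | h
  · have hN0 : (0 : ℝ) < (i + 1).factorial := by positivity
    have hθN : 1 ≤ θ * (α * (i + 1).factorial) := by
      have := mul_le_mul_of_nonneg_left h (show 0 ≤ θ * α by positivity)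
      linarith
    refine le_log_restrictedPartitionCount_of_blocks hα hθ hθ1 hαθ hL hX hn hlarge h1A h hj1 hθN
      (fun a h1 h2 => mem_factorialGapSet hα (j := i) (Nat.cast_lt.1 (lt_of_le_of_lt ?_ h1)) h2)
      (fun a h1 h2 => mem_factorialGapSet hα (j := i + 1) (Nat.cast_lt.1 h1) (h2.trans ?_))
    · rw [hf1]
      have h3 : (i.factorial : ℝ) * 1 ≤ i.factorial * ((i + 1) * (θ * α)) := by
        gcongr
        have : 0 ≤ θ * α := by positivity
        linarith
      linarith
    · rw [hf2]
      calc (1 + θ) * ((i + 1).factorial : ℝ) ≤ (α * (i + 2)) * (i + 1).factorial := by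
            gcongr
            linarith
        _ = _ := by ring
  -- No factorial lies in [X/4, 4X]. If the next gap starts at X/2 or later, large parts just above
  -- X/4 are available. Otherwise that gap starts before X/2 yet ends beyond 4X, so small parts up
  -- to 4αX are available.
  · rcases le_or_gt (X / 2) (α * (i + 2).factorial) with h' | h'
    · obtain ⟨S₂, R, b, hS₂, hR, hch, hlog₂⟩ :=
        exists_large_block hα hθ hθ1 hαθ hL hL0 hX hn le_rfl (by linarith) hlarge
      have hcount := pow_mul_choose_le_restrictedPartitionCount h1A (S₁ := ∅) (S₂ := S₂)
        (M := 0) (R := R) (b := b) (n := n) (by simp) (fun a ha => by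
          obtain ⟨h1, h2, h3, h4⟩ := hS₂ a ha
          refine ⟨mem_factorialGapSet hα (j := i + 1) (by exact_mod_cast h.trans h1)
            (h2.trans (le_trans ?_ h')), h3⟩
          nlinarith) (by simp) (fun a ha => (hS₂ a ha).2.2.2) (by
          have h1 : (R : ℝ) * b ≤ n := by
            have : 0 ≤ θ * n := by positivity
            linarith
          simpa using (by exact_mod_cast h1 : R * b ≤ n))
      rw [Finset.card_empty, pow_zero, one_mul] at hcount
      have hlog := hlogle _ hch hcount
      have e : (n : ℝ) / (X / 4) = 4 * (α * X) := by
        rw [hn]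
        field_simp
      rw [e] at hlog₂
      linarith only [hlog, hlog₂, mul_nonneg hc0 hαX.le]
    · obtain ⟨S₁, M, hS₁, hM, hlog₁⟩ := exists_small_block hα hθ hθ1 hL hL0 hX hn
        (N := 4 * X) (by linarith) le_rfl (by linarith)
      have hsmall : ((i + 1).factorial : ℝ) ≤ θ * (α * (4 * X)) := by
        rw [hf2] at h'
        have h1 : 1 ≤ (i + 2) * (θ * α ^ 2) := hi.trans (by gcongr; linarith)
        have h2 : ((i + 1).factorial : ℝ) * 1 ≤ (i + 1).factorial * ((i + 2) * (θ * α ^ 2)) := by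
          gcongr
        have h3 := mul_le_mul_of_nonneg_left h'.le (show 0 ≤ θ * α by positivity)
        have h4 : 0 ≤ θ * (α * X) := by positivity
        nlinarith
      have hcount := pow_mul_choose_le_restrictedPartitionCount h1A (S₁ := S₁) (S₂ := ∅)
        (M := M) (R := 0) (b := 0) (n := n) (fun a ha => by
          obtain ⟨h1, h2, h3⟩ := hS₁ a ha
          refine ⟨mem_factorialGapSet hα (j := i + 1) (by exact_mod_cast hsmall.trans_lt h1)
            (h2.trans ?_), h3⟩
          exact mul_le_mul_of_nonneg_left hj2.le hα.le) (by simp) (by simp) (by simp) (by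
          have h1 : (M : ℝ) * ((∑ a ∈ S₁, a : ℕ) : ℝ) ≤ n := by
            have : 0 ≤ (1 - θ) * n := mul_nonneg (by linarith) (Nat.cast_nonneg n)
            linarith
          simpa using (by exact_mod_cast h1 : M * ∑ a ∈ S₁, a ≤ n))
      rw [Nat.choose_zero_right, mul_one] at hcount
      have hlog := hlogle _ (by positivity) hcount
      push_cast at hlog
      linarith only [hlog, hlog₁, mul_nonneg hc0 hαX.le]

lemma eventually_le_liminfLogRatio_factorialGapSet {θ : ℝ} (hθ : 0 < θ) (hθ1 : θ ≤ 1 / 10) :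
    ∀ᶠ α in 𝓝[>] (0 : ℝ), (((1 - 4 * θ) * (√6 / Real.pi) * Real.log (1 / α) : ℝ) : EReal) ≤
      liminfLogRatio (factorialGapSet α) α := by
  have hlog : Tendsto (fun α : ℝ => Real.log (1 / α)) (𝓝[>] 0) atTop := by
    simp_rw [one_div]
    exact Real.tendsto_log_atTop.comp tendsto_inv_nhdsGT_zero
  filter_upwards [hlog.eventually (eventually_ge_atTop (Real.log (32 / θ) / θ)),
    Ioo_mem_nhdsGT (show 0 < θ / 64 by positivity)] with α hL hα
  obtain ⟨hα, hαθ⟩ := hα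
  rw [div_le_iff₀' hθ] at hL
  have hL0 : 0 ≤ Real.log (1 / α) := by
    apply Real.log_nonneg
    rw [le_div_iff₀ hα]
    linarith
  have hpi := Real.pi_pos
  obtain ⟨J, hJ⟩ := exists_nat_ge (1 / (θ * α ^ 2))
  rw [div_le_iff₀ (by positivity)] at hJ
  have hX : Tendsto (fun n : ℕ => √((n : ℝ) / α)) atTop atTop :=
    Real.tendsto_sqrt_atTop.comp (tendsto_natCast_atTop_atTop.atTop_div_const hα)
  apply le_liminfLogRatio_of_eventually
  filter_upwards [eventually_log_partitionCount_pos hα,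
    hX.eventually (eventually_ge_atTop (4 / (θ * α))),
    hX.eventually (eventually_ge_atTop (((J + 1).factorial : ℝ) / 4))] with n h1 h2 h3
  refine ⟨h1, restrictedPartitionCount_pos (one_mem_factorialGapSet α) n, ?_⟩
  set X := √((n : ℝ) / α) with hXdef
  have hn : (n : ℝ) = α * X ^ 2 := by
    rw [hXdef, Real.sq_sqrt (by positivity)]
    field_simp
  have hX0 : 0 < X := lt_of_lt_of_le (by positivity) h2
  rw [div_le_iff₀ (by positivity)] at h2
  have key := le_log_restrictedPartitionCount_factorialGapSet hα hθ hθ1 hαθ.le hL hX0 hn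
    (by linarith) hJ (by linarith)
  refine le_trans ?_ key
  have h4 : Real.log (partitionCount ⌊α * (n : ℝ)⌋₊) ≤ 2 * (Real.pi / √6 * (α * X)) := by
    refine (log_partitionCount_le_sqrt _).trans ?_
    rw [sqrt_pi_sq_div_six_mul]
    gcongr
    apply Real.sqrt_le_iff.2 ⟨by positivity, (Nat.floor_le (by positivity)).trans ?_⟩
    rw [hn]
    exact le_of_eq (by ring)
  have hc : 0 ≤ (1 - 4 * θ) * (√6 / Real.pi) * Real.log (1 / α) :=
    mul_nonneg (mul_nonneg (by linarith) (by positivity)) hL0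
  refine (mul_le_mul_of_nonneg_left h4 hc).trans (le_of_eq ?_)
  field_simp

theorem exists_factorialGapSet_attaining_bound : ∃ ε : ℝ → ℝ, Tendsto ε (𝓝[>] 0) (𝓝 0) ∧
      ∀ α : ℝ, 0 < α → α < 1 →
        ∃ A : Set ℕ, (∀ a ∈ A, 0 < a) ∧ Nat.setGcd A = 1 ∧ lowerDensity A = α ∧
          (((1 - ε α) * (√6 / Real.pi) * Real.log (1 / α) : ℝ) : EReal) ≤
            liminfLogRatio A α := by
  have hpi := Real.pi_pos
  obtain ⟨ε, hε, h⟩ := exists_tendsto_zero_of_eventually (P := fun e α =>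
    (((1 - e) * (√6 / Real.pi) * Real.log (1 / α) : ℝ) : EReal) ≤
      liminfLogRatio (factorialGapSet α) α)
    (by
      intro e e' α h0 h1 he h
      refine (EReal.coe_le_coe_iff.2 ?_).trans h
      have hL : 0 ≤ Real.log (1 / α) := Real.log_nonneg ((one_le_div h0).2 h1.le)
      gcongr)
    (by
      intro α h0 h1
      -- Error 1 makes the bound 0, which holds because 1 ∈ A gives p_A(n) ≥ 1.
      refine ⟨1, le_liminfLogRatio_of_eventually ?_⟩
      filter_upwards [eventually_log_partitionCount_pos h0] with n hn
      have hp := restrictedPartitionCount_pos (one_mem_factorialGapSet α) n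
      refine ⟨hn, hp, ?_⟩
      rw [sub_self, zero_mul, zero_mul, zero_mul]
      exact Real.log_nonneg (by exact_mod_cast hp))
    (by
      intro η hη
      filter_upwards [eventually_le_liminfLogRatio_factorialGapSet (θ := min (η / 4) (1 / 10))
        (by positivity) (min_le_right _ _), Ioo_mem_nhdsGT one_pos] with α h hα
      refine (EReal.coe_le_coe_iff.2 ?_).trans h
      have hL : 0 ≤ Real.log (1 / α) := Real.log_nonneg ((one_le_div hα.1).2 hα.2.le)
      have h2 : 4 * min (η / 4) (1 / 10) ≤ η := by
        have := min_le_left (η / 4) (1 / 10)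
        linarith
      gcongr)
  refine ⟨ε, hε, fun α h0 h1 => ⟨factorialGapSet α, fun a ha => ha.1, ?_,
    lowerDensity_factorialGapSet h0 h1, h α h0 h1⟩⟩
  exact Nat.dvd_one.1 (Nat.setGcd_dvd_of_mem (one_mem_factorialGapSet α))

theorem theorem2 :
    (∃ ε : ℝ → ℝ, Tendsto ε (𝓝[>] 0) (𝓝 0) ∧
      ∀ α : ℝ, 0 < α → α < 1 →
        ∃ A : Set ℕ, (∀ a ∈ A, 0 < a) ∧ Nat.setGcd A = 1 ∧ lowerDensity A = α ∧
          (((1 - ε α) * (√6 / Real.pi) * Real.log (1 / α) : ℝ) : EReal) ≤ liminfLogRatio A α) ∧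
    (∃ ε : ℝ → ℝ, Tendsto ε (𝓝[>] 0) (𝓝 0) ∧
      ∀ α : ℝ, 0 < α → α < 1 →
        ∀ A : Set ℕ, (∀ a ∈ A, 0 < a) → lowerDensity A = α →
          liminfLogRatio A α ≤ (((1 + ε α) * (√6 / Real.pi) * Real.log (1 / α) : ℝ) : EReal)) := by
  exact ⟨exists_factorialGapSet_attaining_bound, liminfLogRatio_le_of_lowerDensity_eq⟩
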